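/- Let $C_3$ be the cycle on three vertices. A \emph{drawing} of $C_3$ places its vertices at points of $\mathbb{R}^2$ and draws its edges as straight-line segments, such that the vertices are pairwise distinct and the edges do not cross (the segments meet vertices and one another only at common endpoints). Let $\Gamma_1$ and $\Gamma_2$ be two drawings of $C_3$, and let $P\subset\mathbb{R}^2$ be a set of at most four points, called obstacles. Suppose that $P$ is \emph{compatible} with $\Gamma_1$ and $\Gamma_2$, i.e., there is a continuous deformation that transforms $\Gamma_1$ into $\Gamma_2$ such that, at all times, the edges are noncrossing (but not necessarily straight-line) curves and no obstacle lies on a vertex or an edge. Then $\Gamma_1$ and $\Gamma_2$ are not blocked by $P$, i.e., there is a continuous deformation from $\Gamma_1$ to $\Gamma_2$ through (noncrossing, straight-line) drawings of $C_3$ such that, at all times, no obstacle lies on a vertex or an edge. -/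

import Mathlib

/-- The Euclidean plane. -/
abbrev Plane : Type := EuclideanSpace ℝ (Fin 2)

/-- A graph `G` drawn in the plane with arbitrary continuous curves as edges, crossings still being
allowed: a point for every vertex and, for every oriented edge (dart) `d`, a curve from the point of
its first to the point of its second end vertex. The two orientations of an edge give the same curve,
traversed in opposite directions. Equivalently, a continuous map from the topological realization
of `G` to the plane. -/
@[ext]
structure CurveDrawing {V : Type*} (G : SimpleGraph V) where
  vert : V → Plane
  edge : G.Dart → unitInterval → Plane
  continuous_edge : ∀ d, Continuous (edge d)
  edge_zero : ∀ d, edge d 0 = vert d.fst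
  edge_symm : ∀ d s, edge d.symm s = edge d (unitInterval.symm s)

namespace CurveDrawing

/-- No crossings: distinct points of the topological realization of `G` are mapped to distinct points
of the plane, i.e. the vertices are pairwise distinct points, the edges are simple curves, and they
meet vertices and each other only at common ends. -/
structure Noncrossing {V : Type*} {G : SimpleGraph V} (D : CurveDrawing G) : Prop where
  vert_injective : Function.Injective D.vert
  edge_ne_vert : ∀ (d : G.Dart) (s : unitInterval) (v : V), 0 < s → s < 1 → D.edge d s ≠ D.vert v
  edge_eq_edge : ∀ (d d' : G.Dart) (s s' : unitInterval), 0 < s → s < 1 → 0 < s' → s' < 1 →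
    D.edge d s = D.edge d' s' →
      (d' = d ∧ s' = s) ∨ (d' = d.symm ∧ s' = unitInterval.symm s)

/-- The set of points of the plane that are covered by the vertices and edges. -/
def support {V : Type*} {G : SimpleGraph V} (D : CurveDrawing G) : Set Plane :=
  Set.range D.vert ∪ ⋃ d : G.Dart, Set.range (D.edge d)

/-- No obstacle lies on a vertex or an edge. -/
def Avoids {V : Type*} {G : SimpleGraph V} (D : CurveDrawing G) (P : Finset Plane) : Prop :=
  Disjoint D.support (P : Set Plane)

end CurveDrawing

/-- The vertices of `G` are placed by `Γ` and the edges are straight-line segments,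
parametrized at constant speed. -/
noncomputable def straightLine {V : Type*} (G : SimpleGraph V) (Γ : V → Plane) : CurveDrawing G where
  vert := Γ
  edge d s := AffineMap.lineMap (Γ d.fst) (Γ d.snd) (s : ℝ)
  continuous_edge d := by
    have h : Continuous (AffineMap.lineMap (Γ d.fst) (Γ d.snd) : ℝ → Plane) :=
      AffineMap.lineMap_continuous
    exact h.comp continuous_subtype_val
  edge_zero d := by simp
  edge_symm d s := by
    simp [AffineMap.lineMap_apply_one_sub]

/-- `Γ` is a (crossing-free, straight-line) drawing of `G` in the plane. -/
def IsDrawing {V : Type*} (G : SimpleGraph V) (Γ : V → Plane) : Prop :=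
  (straightLine G Γ).Noncrossing

/-- `M` is a planar morph from `Γ₁` to `Γ₂`: a continuous deformation through crossing-free
straight-line drawings. -/
structure IsPlanarMorph {V : Type*} (G : SimpleGraph V) (Γ₁ Γ₂ : V → Plane)
    (M : unitInterval → V → Plane) : Prop where
  continuous : Continuous M
  source : M 0 = Γ₁
  target : M 1 = Γ₂
  isDrawing : ∀ t, IsDrawing G (M t)

/-- `Γ₁` and `Γ₂` are blocked by `P`: there is no planar morph between them that avoids `P`. -/
def Blocked {V : Type*} (G : SimpleGraph V) (Γ₁ Γ₂ : V → Plane) (P : Finset Plane) : Prop :=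
  ¬ ∃ M : unitInterval → V → Plane,
    IsPlanarMorph G Γ₁ Γ₂ M ∧ ∀ t, (straightLine G (M t)).Avoids P

/-- `P` is compatible with `Γ₁` and `Γ₂`: there is a continuous deformation from `Γ₁` to `Γ₂` that
avoids `P` and keeps the edges noncrossing, but not necessarily straight. -/
def Compatible {V : Type*} (G : SimpleGraph V) (Γ₁ Γ₂ : V → Plane) (P : Finset Plane) : Prop :=
  ∃ D : unitInterval → CurveDrawing G,
    (∀ v, Continuous fun t => (D t).vert v) ∧
    (∀ d, Continuous fun p : unitInterval × unitInterval => (D p.1).edge d p.2) ∧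
    D 0 = straightLine G Γ₁ ∧ D 1 = straightLine G Γ₂ ∧
    ∀ t, (D t).Noncrossing ∧ (D t).Avoids P

open unitInterval in
theorem exists_continuous_log (H : I × I → ℂ) (hH : Continuous H) (h0 : ∀ p, H p ≠ 0) :
    ∃ L : I × I → ℂ, Continuous L ∧ ∀ p, Complex.exp (L p) = H p := by
  have cov := Complex.isCoveringMap_exp
  let H' : C(I × I, {z : ℂ // z ≠ 0}) := ⟨fun p => ⟨H p, h0 p⟩, by fun_prop⟩
  let γ : C(I, {z : ℂ // z ≠ 0}) := ⟨fun s => H' (0, s), by fun_prop⟩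
  have hγ : γ 0 = (⟨_, (Complex.log (H (0, 0))).exp_ne_zero⟩ : {z : ℂ // z ≠ 0}) :=
    Subtype.ext (Complex.exp_log (h0 _)).symm
  let f := cov.liftPath γ (Complex.log (H (0, 0))) hγ
  have hf : ∀ a, H' (0, a) = (⟨_, (f a).exp_ne_zero⟩ : {z : ℂ // z ≠ 0}) := fun a =>
    (congrFun (cov.liftPath_lifts γ _ hγ) a).symm
  refine ⟨cov.liftHomotopy H' f hf, map_continuous _, fun p => ?_⟩
  exact congrArg Subtype.val (congrFun (cov.liftHomotopy_lifts H' f hf) p)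

theorem eq_of_exp_eq {X : Type*} [TopologicalSpace X] [PreconnectedSpace X] {f g : X → ℂ}
    (hf : Continuous f) (hg : Continuous g) (h : ∀ x, Complex.exp (f x) = Complex.exp (g x))
    (x₀ : X) (h₀ : f x₀ = g x₀) (x : X) : f x = g x :=
  congrFun (Complex.isCoveringMap_exp.eq_of_comp_eq hf hg
    (funext fun x => Subtype.ext (h x)) x₀ h₀) x

theorem segment_one_mem_slitPlane {w : ℂ} (h : ∀ s : unitInterval, 1 + (s : ℂ) * (w - 1) ≠ 0)
    (s : unitInterval) : 1 + (s : ℂ) * (w - 1) ∈ Complex.slitPlane := by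
  rw [Complex.mem_slitPlane_iff]
  by_contra! hc
  obtain ⟨h1, h2⟩ := hc
  have hs := s.2
  simp only [Complex.add_re, Complex.one_re, Complex.mul_re, Complex.ofReal_re, Complex.sub_re,
    Complex.ofReal_im, Complex.sub_im, Complex.one_im, Complex.add_im, Complex.mul_im] at h1 h2
  have hw : w.im = 0 := by
    have : (s : ℝ) * w.im = 0 := by linarith
    rcases mul_eq_zero.1 this with h | h
    · rw [h] at h1; linarith
    · exact h
  have hre : w.re ≤ 0 := by
    by_contra! hc
    rcases eq_or_lt_of_le hs.1 with h | h
    · rw [← h] at h1; linarith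
    · nlinarith [hs.2, mul_pos h hc]
  have hpos : 0 < 1 - w.re := by linarith
  refine h ⟨1 / (1 - w.re), by positivity, by rw [div_le_one hpos]; linarith⟩ ?_
  apply Complex.ext
  · simp only [Complex.add_re, Complex.one_re, Complex.mul_re, Complex.ofReal_re, Complex.sub_re,
      Complex.ofReal_im, Complex.sub_im, Complex.one_im, Complex.zero_re]
    field_simp
    ring
  · simp [hw]

theorem slitPlane_of_segment {u v : ℂ}
    (h : ∀ s : unitInterval, u + (s : ℂ) * (v - u) ≠ 0) : v / u ∈ Complex.slitPlane ∧
      ∀ s : unitInterval, 1 + (s : ℂ) * (v / u - 1) ∈ Complex.slitPlane := by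
  have hu : u ≠ 0 := by simpa using h 0
  have key := segment_one_mem_slitPlane (w := v / u) (fun s hs => h s (by
    have := congrArg (u * ·) hs
    simp only [mul_zero] at this
    rw [← this]
    field_simp))
  exact ⟨by simpa using key 1, key⟩

theorem log_increment_of_segment {u v : ℂ} (L : unitInterval → ℂ) (hL : Continuous L)
    (h : ∀ s : unitInterval, Complex.exp (L s) = u + (s : ℂ) * (v - u)) :
    L 1 - L 0 = Complex.log (v / u) := by
  have hne : ∀ s : unitInterval, u + (s : ℂ) * (v - u) ≠ 0 := fun s => by
    rw [← h s]; exact Complex.exp_ne_zero _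
  have hu : u ≠ 0 := by simpa using hne 0
  obtain ⟨-, hs⟩ := slitPlane_of_segment hne
  have key := eq_of_exp_eq (f := L) (g := fun s => L 0 + Complex.log (1 + (s : ℂ) * (v / u - 1)))
    hL ?_ ?_ 0 (by simp) 1
  · rw [key]; simp
  · refine continuous_const.add (Continuous.clog ?_ hs)
    fun_prop
  · intro s
    rw [Complex.exp_add, Complex.exp_log (Complex.slitPlane_ne_zero (hs s)), h, h]
    simp only [Set.Icc.coe_zero, Complex.ofReal_zero]
    field_simp
    ring

open unitInterval in
/-- Total variation of the argument is preserved by homotopies in the punctured plane whose product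
of end ratios stays constant. -/
theorem sum_log_eq {ι : Type*} [Fintype ι] (H : ι → I × I → ℂ) (hH : ∀ i, Continuous (H i))
    (h0 : ∀ i p, H i p ≠ 0) (c : ℂ) (hc : ∀ t, ∏ i, H i (t, 1) / H i (t, 0) = c)
    (u v u' v' : ι → ℂ) (hs : ∀ i (s : I), H i (0, s) = u i + (s : ℂ) * (v i - u i))
    (ht : ∀ i (s : I), H i (1, s) = u' i + (s : ℂ) * (v' i - u' i)) :
    ∑ i, Complex.log (v i / u i) = ∑ i, Complex.log (v' i / u' i) := by
  choose L hL hexp using fun i => exists_continuous_log (H i) (hH i) (h0 i)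
  have key := eq_of_exp_eq (f := fun t : I => ∑ i, (L i (t, 1) - L i (t, 0)))
    (g := fun _ => ∑ i, (L i (0, 1) - L i (0, 0)))
    (continuous_finsetSum _ fun i _ => by have := hL i; fun_prop) continuous_const
    (fun t => by simp_rw [Complex.exp_sum, Complex.exp_sub, hexp, hc]) 0 rfl 1
  have e0 : ∀ i, L i (0, 1) - L i (0, 0) = Complex.log (v i / u i) := fun i =>
    log_increment_of_segment (fun s => L i (0, s)) (by have := hL i; fun_prop)
      fun s => by rw [hexp, hs]
  have e1 : ∀ i, L i (1, 1) - L i (1, 0) = Complex.log (v' i / u' i) := fun i =>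
    log_increment_of_segment (fun s => L i (1, s)) (by have := hL i; fun_prop)
      fun s => by rw [hexp, ht]
  simp only [e0, e1] at key
  exact key.symm

theorem arg_pos_iff_of_mem_slitPlane {z : ℂ} (hz : z ∈ Complex.slitPlane) :
    0 < z.arg ↔ 0 < z.im := by
  rcases lt_trichotomy z.im 0 with h | h | h
  · have := Complex.arg_neg_iff.2 h
    constructor <;> intro <;> linarith
  · have h1 : 0 < z.re := by
      rcases Complex.mem_slitPlane_iff.1 hz with h2 | h2
      · exact h2
      · exact absurd h h2
    have := Complex.arg_eq_zero_iff.2 ⟨h1.le, h⟩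
    rw [h, this]
  · refine iff_of_true ?_ h
    have h1 := Complex.arg_nonneg_iff.2 h.le
    refine lt_of_le_of_ne h1 fun h2 => ?_
    have := (Complex.arg_eq_zero_iff.1 h2.symm).2
    linarith

theorem div_im_pos_iff (u v : ℂ) : 0 < (v / u).im ↔ 0 < u.re * v.im - u.im * v.re := by
  by_cases hu : u = 0
  · simp [hu]
  have hn : 0 < Complex.normSq u := Complex.normSq_pos.2 hu
  have : (v / u).im = (u.re * v.im - u.im * v.re) / Complex.normSq u := by
    rw [Complex.div_im]; ring
  rw [this, div_pos_iff_of_pos_right hn]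

theorem div_im_neg_iff (u v : ℂ) : (v / u).im < 0 ↔ u.re * v.im - u.im * v.re < 0 := by
  by_cases hu : u = 0
  · simp [hu]
  have hn : 0 < Complex.normSq u := Complex.normSq_pos.2 hu
  have : (v / u).im = (u.re * v.im - u.im * v.re) / Complex.normSq u := by
    rw [Complex.div_im]; ring
  rw [this, div_neg_iff]
  constructor
  · rintro (h | h)
    · linarith [h.2]
    · exact h.1
  · intro h; exact Or.inr ⟨h, hn⟩

/-- Twice the signed area of the triangle `p q r`. -/
def signedArea (p q r : Plane) : ℝ := (q 0 - p 0) * (r 1 - p 1) - (q 1 - p 1) * (r 0 - p 0)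

def toComplex (x : Plane) : ℂ := ⟨x 0, x 1⟩

theorem toComplex_injective : Function.Injective toComplex := by
  intro x y h
  ext i
  fin_cases i
  · exact congrArg Complex.re h
  · exact congrArg Complex.im h

theorem continuous_toComplex : Continuous toComplex := by
  have : toComplex = fun x : Plane => ((x 0 : ℝ) : ℂ) + ((x 1 : ℝ) : ℂ) * Complex.I := by
    funext x; exact (Complex.mk_eq_add_mul_I _ _)
  rw [this]; fun_prop

theorem toComplex_lineMap (x y : Plane) (s : ℝ) :
    toComplex (AffineMap.lineMap x y s) = toComplex x + (s : ℂ) * (toComplex y - toComplex x) := by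
  apply Complex.ext <;> simp [toComplex, AffineMap.lineMap_apply] <;> ring

/-- The dart from `i` to `i + 1`. -/
def cycleDart (i : Fin 3) : (SimpleGraph.cycleGraph 3).Dart :=
  ⟨(i, i + 1), by revert i; decide⟩

theorem CurveDrawing.edge_one {V : Type*} {G : SimpleGraph V} (D : CurveDrawing G) (d : G.Dart) :
    D.edge d 1 = D.vert d.snd := by
  have := D.edge_symm d 0
  rw [unitInterval.symm_zero, D.edge_zero] at this
  exact this.symm

theorem CurveDrawing.Avoids.edge_ne {V : Type*} {G : SimpleGraph V} {D : CurveDrawing G}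
    {P : Finset Plane} (h : D.Avoids P) (d : G.Dart) (s : unitInterval) {x : Plane} (hx : x ∈ P) :
    D.edge d s ≠ x := by
  rintro rfl
  exact Set.disjoint_left.1 h (Or.inr (Set.mem_iUnion.2 ⟨d, s, rfl⟩)) hx

theorem CurveDrawing.Noncrossing.edge_ne_vert_of_ne {V : Type*} {G : SimpleGraph V}
    {D : CurveDrawing G} (h : D.Noncrossing) (d : G.Dart) (s : unitInterval) {v : V}
    (h1 : v ≠ d.fst) (h2 : v ≠ d.snd) : D.edge d s ≠ D.vert v := by
  rcases eq_or_lt_of_le s.2.1 with h0 | h0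
  · have : s = 0 := Subtype.ext h0.symm
    rw [this, D.edge_zero]
    exact fun h' => h1 (h.vert_injective h').symm
  rcases eq_or_lt_of_le s.2.2 with h3 | h3
  · have : s = 1 := Subtype.ext h3
    rw [this, D.edge_one]
    exact fun h' => h2 (h.vert_injective h').symm
  exact h.edge_ne_vert d s v h0 h3

theorem signedArea_eq_cross (p q r : Plane) :
    (toComplex q - toComplex p).re * (toComplex r - toComplex p).im -
      (toComplex q - toComplex p).im * (toComplex r - toComplex p).re = signedArea p q r := by
  simp [toComplex, signedArea]

theorem signedArea_rotate (p q r : Plane) : signedArea q r p = signedArea p q r := by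
  simp only [signedArea]; ring

/-- Sign of the rotation of an oriented segment `u → v` avoiding the origin. -/
theorem segment_arg_pos_iff {u v : ℂ} (h : ∀ s : unitInterval, u + (s : ℂ) * (v - u) ≠ 0) :
    0 < (v / u).arg ↔ 0 < u.re * v.im - u.im * v.re := by
  rw [arg_pos_iff_of_mem_slitPlane (slitPlane_of_segment h).1, div_im_pos_iff]

theorem segment_arg_neg_iff (u v : ℂ) :
    (v / u).arg < 0 ↔ u.re * v.im - u.im * v.re < 0 := by
  rw [Complex.arg_neg_iff, div_im_neg_iff]

theorem segment_arg_mem {u v : ℂ} (h : ∀ s : unitInterval, u + (s : ℂ) * (v - u) ≠ 0) :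
    -Real.pi < (v / u).arg ∧ (v / u).arg < Real.pi :=
  ⟨Complex.neg_pi_lt_arg _, lt_of_le_of_ne (Complex.arg_le_pi _)
    (Complex.mem_slitPlane_iff_arg.1 (slitPlane_of_segment h).1).1⟩

open unitInterval in
theorem sum_arg_eq {ι : Type*} [Fintype ι] (H : ι → I × I → ℂ) (hH : ∀ i, Continuous (H i))
    (h0 : ∀ i p, H i p ≠ 0) (c : ℂ) (hc : ∀ t, ∏ i, H i (t, 1) / H i (t, 0) = c)
    (u v u' v' : ι → ℂ) (hs : ∀ i (s : I), H i (0, s) = u i + (s : ℂ) * (v i - u i))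
    (ht : ∀ i (s : I), H i (1, s) = u' i + (s : ℂ) * (v' i - u' i)) :
    ∑ i, (v i / u i).arg = ∑ i, (v' i / u' i).arg := by
  have := congrArg Complex.im (sum_log_eq H hH h0 c hc u v u' v' hs ht)
  simpa [Complex.im_sum, Complex.log_im] using this

theorem all_pos_of_sum_eq {θ φ : Fin 3 → ℝ} (hφ : ∀ i, φ i < Real.pi) (hsum : ∑ i, θ i = ∑ i, φ i)
    (n : ℤ) (hn : ∑ i, φ i = n * (2 * Real.pi)) (hθ : ∀ i, 0 < θ i) (i : Fin 3) : 0 < φ i := by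
  have hpi := Real.pi_pos
  have h1 : 0 < ∑ i, θ i := Finset.sum_pos (fun i _ => hθ i) Finset.univ_nonempty
  rw [hsum, hn] at h1
  have h2 : 0 < (n : ℝ) := by
    by_contra! h
    nlinarith
  have h3 : (1 : ℝ) ≤ n := by exact_mod_cast Int.cast_pos.1 h2
  have h4 : 2 * Real.pi ≤ ∑ i, φ i := by rw [hn]; nlinarith
  rw [Fin.sum_univ_three] at h4
  fin_cases i <;> simp <;> linarith [hφ 0, hφ 1, hφ 2]

section Isotopy

variable {Γ₁ Γ₂ : Fin 3 → Plane} {P : Finset Plane}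

theorem straightLine_toComplex (Γ : Fin 3 → Plane) (i : Fin 3) (s : unitInterval) :
    toComplex ((straightLine (SimpleGraph.cycleGraph 3) Γ).edge (cycleDart i) s) =
      toComplex (Γ i) + (s : ℂ) * (toComplex (Γ (i + 1)) - toComplex (Γ i)) :=
  toComplex_lineMap _ _ _

/-- The winding number around an obstacle is the same for both triangles. -/
theorem Compatible.inside (h : Compatible (SimpleGraph.cycleGraph 3) Γ₁ Γ₂ P) {x : Plane}
    (hx : x ∈ P) :
    ((∀ i, 0 < signedArea x (Γ₁ i) (Γ₁ (i + 1))) → ∀ i, 0 < signedArea x (Γ₂ i) (Γ₂ (i + 1))) ∧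
    ((∀ i, signedArea x (Γ₁ i) (Γ₁ (i + 1)) < 0) → ∀ i, signedArea x (Γ₂ i) (Γ₂ (i + 1)) < 0) := by
  obtain ⟨D, -, hE, hD0, hD1, hD⟩ := h
  let H : Fin 3 → unitInterval × unitInterval → ℂ := fun i p =>
    toComplex ((D p.1).edge (cycleDart i) p.2) - toComplex x
  have hH : ∀ i, Continuous (H i) := fun i =>
    (continuous_toComplex.comp (hE (cycleDart i))).sub continuous_const
  have h0 : ∀ i p, H i p ≠ 0 := fun i p =>
    sub_ne_zero.2 (toComplex_injective.ne ((hD p.1).2.edge_ne _ _ hx))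
  have hc : ∀ t, ∏ i, H i (t, 1) / H i (t, 0) = 1 := fun t => by
    have e0 : ∀ i, H i (t, 0) = toComplex ((D t).vert i) - toComplex x := fun i => by
      simp only [H, (D t).edge_zero]; rfl
    have e1 : ∀ i, H i (t, 1) = toComplex ((D t).vert (i + 1)) - toComplex x := fun i => by
      simp only [H, (D t).edge_one]; rfl
    have hn : ∀ i, toComplex ((D t).vert i) - toComplex x ≠ 0 := fun i => by
      rw [← e0]; exact h0 _ _
    simp only [e0, e1, Fin.prod_univ_three]
    have a0 := hn 0
    have a1 := hn 1
    have a2 := hn 2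
    have e3 : (2 : Fin 3) + 1 = 0 := rfl
    have e4 : (1 : Fin 3) + 1 = 2 := rfl
    rw [zero_add, e3, e4]
    field_simp
  have hs : ∀ i (s : unitInterval), H i (0, s) = (toComplex (Γ₁ i) - toComplex x) + (s : ℂ) *
      ((toComplex (Γ₁ (i + 1)) - toComplex x) - (toComplex (Γ₁ i) - toComplex x)) := fun i s => by
    simp only [H, hD0, straightLine_toComplex]; ring
  have ht : ∀ i (s : unitInterval), H i (1, s) = (toComplex (Γ₂ i) - toComplex x) + (s : ℂ) *
      ((toComplex (Γ₂ (i + 1)) - toComplex x) - (toComplex (Γ₂ i) - toComplex x)) := fun i s => by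
    simp only [H, hD1, straightLine_toComplex]; ring
  have hsum := sum_arg_eq H hH h0 1 hc _ _ _ _ hs ht
  have n1 : ∀ i (s : unitInterval), _ ≠ _ := fun i s => (hs i s) ▸ h0 i (0, s)
  have n2 : ∀ i (s : unitInterval), _ ≠ _ := fun i s => (ht i s) ▸ h0 i (1, s)
  have hn : ∃ n : ℤ, ∑ i, ((toComplex (Γ₂ (i + 1)) - toComplex x) /
      (toComplex (Γ₂ i) - toComplex x)).arg = n * (2 * Real.pi) := by
    have h1 : Complex.exp (∑ i, Complex.log ((toComplex (Γ₂ (i + 1)) - toComplex x) /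
        (toComplex (Γ₂ i) - toComplex x))) = 1 := by
      rw [Complex.exp_sum, ← hc 1]
      refine Finset.prod_congr rfl fun i _ => ?_
      rw [Complex.exp_log (Complex.slitPlane_ne_zero (slitPlane_of_segment (n2 i)).1), ht, ht]
      simp
    obtain ⟨n, hn⟩ := Complex.exp_eq_one_iff.1 h1
    refine ⟨n, ?_⟩
    have := congrArg Complex.im hn
    simpa [Complex.im_sum, Complex.log_im] using this
  obtain ⟨n, hn⟩ := hn
  simp_rw [← signedArea_eq_cross, ← segment_arg_pos_iff (n1 _), ← segment_arg_pos_iff (n2 _),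
    ← segment_arg_neg_iff]
  constructor
  · exact fun h => all_pos_of_sum_eq (fun i => (segment_arg_mem (n2 i)).2) hsum n hn h
  · intro h i
    have := all_pos_of_sum_eq
      (θ := fun i => -((toComplex (Γ₁ (i + 1)) - toComplex x) / (toComplex (Γ₁ i) - toComplex x)).arg)
      (φ := fun i => -((toComplex (Γ₂ (i + 1)) - toComplex x) / (toComplex (Γ₂ i) - toComplex x)).arg)
      (fun i => by linarith [(segment_arg_mem (n2 i)).1])
      (by simp only [Finset.sum_neg_distrib, hsum]) (-n)
      (by simp only [Finset.sum_neg_distrib, hn]; push_cast; ring)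
      (fun i => by linarith [h i]) i
    linarith

/-- The sum of the oriented interior angles is preserved. -/
theorem Compatible.orientation (h : Compatible (SimpleGraph.cycleGraph 3) Γ₁ Γ₂ P) :
    (0 < signedArea (Γ₁ 0) (Γ₁ 1) (Γ₁ 2) → 0 < signedArea (Γ₂ 0) (Γ₂ 1) (Γ₂ 2)) ∧
    (signedArea (Γ₁ 0) (Γ₁ 1) (Γ₁ 2) < 0 → signedArea (Γ₂ 0) (Γ₂ 1) (Γ₂ 2) < 0) := by
  obtain ⟨D, hV, hE, hD0, hD1, hD⟩ := h
  let H : Fin 3 → unitInterval × unitInterval → ℂ := fun i p =>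
    toComplex ((D p.1).edge (cycleDart (i + 1)) p.2) - toComplex ((D p.1).vert i)
  have hH : ∀ i, Continuous (H i) := fun i =>
    (continuous_toComplex.comp (hE (cycleDart (i + 1)))).sub
      (continuous_toComplex.comp ((hV i).comp continuous_fst))
  have h0 : ∀ i p, H i p ≠ 0 := fun i p =>
    sub_ne_zero.2 (toComplex_injective.ne ((hD p.1).1.edge_ne_vert_of_ne _ _
      (by simp only [cycleDart]; revert i; decide) (by simp only [cycleDart]; revert i; decide)))
  have e5 : ∀ i : Fin 3, i + 1 + 1 = i + 2 := by decide
  have hc : ∀ t, ∏ i, H i (t, 1) / H i (t, 0) = -1 := fun t => by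
    have e0 : ∀ i, H i (t, 0) = toComplex ((D t).vert (i + 1)) - toComplex ((D t).vert i) :=
      fun i => by simp only [H, (D t).edge_zero]; rfl
    have e1 : ∀ i, H i (t, 1) = toComplex ((D t).vert (i + 2)) - toComplex ((D t).vert i) :=
      fun i => by simp only [H, (D t).edge_one]; rw [← e5]; rfl
    have hn : ∀ i, toComplex ((D t).vert (i + 1)) - toComplex ((D t).vert i) ≠ 0 := fun i => by
      rw [← e0]; exact h0 _ _
    simp only [e0, e1, Fin.prod_univ_three]
    have a0 := hn 0
    have a1 := hn 1
    have a2 := hn 2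
    have e3 : (2 : Fin 3) + 1 = 0 := rfl
    have e4 : (1 : Fin 3) + 1 = 2 := rfl
    have e6 : (1 : Fin 3) + 2 = 0 := rfl
    have e7 : (2 : Fin 3) + 2 = 1 := rfl
    rw [e3] at a2
    rw [e4] at a1
    rw [zero_add] at a0
    rw [zero_add, zero_add, e3, e4, e6, e7]
    field_simp
    ring
  have hs : ∀ i (s : unitInterval), H i (0, s) = (toComplex (Γ₁ (i + 1)) - toComplex (Γ₁ i)) +
      (s : ℂ) * ((toComplex (Γ₁ (i + 2)) - toComplex (Γ₁ i)) -
        (toComplex (Γ₁ (i + 1)) - toComplex (Γ₁ i))) := fun i s => by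
    simp only [H, hD0, straightLine_toComplex, ← e5]; simp only [straightLine]; ring
  have ht : ∀ i (s : unitInterval), H i (1, s) = (toComplex (Γ₂ (i + 1)) - toComplex (Γ₂ i)) +
      (s : ℂ) * ((toComplex (Γ₂ (i + 2)) - toComplex (Γ₂ i)) -
        (toComplex (Γ₂ (i + 1)) - toComplex (Γ₂ i))) := fun i s => by
    simp only [H, hD1, straightLine_toComplex, ← e5]; simp only [straightLine]; ring
  have hsum := sum_arg_eq H hH h0 (-1) hc _ _ _ _ hs ht
  have n1 : ∀ i (s : unitInterval), _ ≠ _ := fun i s => (hs i s) ▸ h0 i (0, s)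
  have n2 : ∀ i (s : unitInterval), _ ≠ _ := fun i s => (ht i s) ▸ h0 i (1, s)
  have area : ∀ (Γ : Fin 3 → Plane) (i : Fin 3),
      signedArea (Γ i) (Γ (i + 1)) (Γ (i + 2)) = signedArea (Γ 0) (Γ 1) (Γ 2) := fun Γ i => by
    fin_cases i
    · rfl
    · exact signedArea_rotate _ _ _
    · exact (signedArea_rotate _ _ _).trans (signedArea_rotate _ _ _)
  have p1 := fun i => segment_arg_pos_iff (n1 i)
  have p2 := fun i => segment_arg_pos_iff (n2 i)
  have m1 := fun i => segment_arg_neg_iff (toComplex (Γ₁ (i + 1)) - toComplex (Γ₁ i))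
    (toComplex (Γ₁ (i + 2)) - toComplex (Γ₁ i))
  have m2 := fun i => segment_arg_neg_iff (toComplex (Γ₂ (i + 1)) - toComplex (Γ₂ i))
    (toComplex (Γ₂ (i + 2)) - toComplex (Γ₂ i))
  simp only [signedArea_eq_cross, area] at p1 p2 m1 m2
  constructor
  · intro h
    by_contra hcon
    have l : ∑ i, ((toComplex (Γ₂ (i + 2)) - toComplex (Γ₂ i)) /
        (toComplex (Γ₂ (i + 1)) - toComplex (Γ₂ i))).arg ≤ 0 :=
      Finset.sum_nonpos fun i _ => not_lt.1 fun h' => hcon ((p2 i).1 h')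
    have g := Finset.sum_pos (fun i _ => (p1 i).2 h) Finset.univ_nonempty
    linarith
  · intro h
    by_contra hcon
    have l : 0 ≤ ∑ i, ((toComplex (Γ₂ (i + 2)) - toComplex (Γ₂ i)) /
        (toComplex (Γ₂ (i + 1)) - toComplex (Γ₂ i))).arg :=
      Finset.sum_nonneg fun i _ => not_lt.1 fun h' => hcon ((m2 i).1 h')
    have g := Finset.sum_neg (fun i _ => (m1 i).2 h) Finset.univ_nonempty
    linarith

end Isotopy

def triangleArea (Γ : Fin 3 → Plane) : ℝ := signedArea (Γ 0) (Γ 1) (Γ 2)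

theorem plane_ext {x y : Plane} (h0 : x 0 = y 0) (h1 : x 1 = y 1) : x = y := by
  ext i; fin_cases i <;> assumption

theorem mem_segment_iff_coord {x p q : Plane} : x ∈ segment ℝ p q ↔
    ∃ t : ℝ, 0 ≤ t ∧ t ≤ 1 ∧ x 0 = (1 - t) * p 0 + t * q 0 ∧ x 1 = (1 - t) * p 1 + t * q 1 := by
  rw [segment_eq_image]
  constructor
  · rintro ⟨t, ht, rfl⟩
    exact ⟨t, ht.1, ht.2, by simp, by simp⟩
  · rintro ⟨t, h0, h1, hx, hy⟩
    exact ⟨t, ⟨h0, h1⟩, plane_ext (by simp [hx]) (by simp [hy])⟩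

theorem cycleGraph_three_adj (v w : Fin 3) : (SimpleGraph.cycleGraph 3).Adj v w ↔ v ≠ w := by
  revert v w; decide

/-- Barycentric weights of the point at parameter `s` on the segment from vertex `i` to `j`. -/
def edgeWeight (i j : Fin 3) (s : ℝ) (k : Fin 3) : ℝ :=
  (if k = i then 1 - s else 0) + (if k = j then s else 0)

theorem sum_edgeWeight (i j : Fin 3) (s : ℝ) (f : Fin 3 → ℝ) :
    ∑ k, edgeWeight i j s k * f k = (1 - s) * f i + s * f j := by
  simp [edgeWeight, add_mul, Finset.sum_add_distrib]

theorem weights_unique {Γ : Fin 3 → Plane} (h : triangleArea Γ ≠ 0) {w w' : Fin 3 → ℝ}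
    (h1 : ∑ k, w k = ∑ k, w' k) (hx : ∑ k, w k * Γ k 0 = ∑ k, w' k * Γ k 0)
    (hy : ∑ k, w k * Γ k 1 = ∑ k, w' k * Γ k 1) : w = w' := by
  simp only [Fin.sum_univ_three] at h1 hx hy
  have e1 : (w 1 - w' 1) * triangleArea Γ = 0 := by
    simp only [triangleArea, signedArea]
    linear_combination (Γ 2 1 - Γ 0 1) * hx - (Γ 2 0 - Γ 0 0) * hy +
      ((Γ 2 0 - Γ 0 0) * Γ 0 1 - (Γ 2 1 - Γ 0 1) * Γ 0 0) * h1
  have e2 : (w 2 - w' 2) * triangleArea Γ = 0 := by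
    simp only [triangleArea, signedArea]
    linear_combination (Γ 1 0 - Γ 0 0) * hy - (Γ 1 1 - Γ 0 1) * hx +
      ((Γ 1 1 - Γ 0 1) * Γ 0 0 - (Γ 1 0 - Γ 0 0) * Γ 0 1) * h1
  have g1 : w 1 = w' 1 := by
    rcases mul_eq_zero.1 e1 with h' | h'
    · linarith
    · exact absurd h' h
  have g2 : w 2 = w' 2 := by
    rcases mul_eq_zero.1 e2 with h' | h'
    · linarith
    · exact absurd h' h
  funext k
  fin_cases k
  · simp; linarith
  · exact g1
  · exact g2

theorem edgeWeight_unique {Γ : Fin 3 → Plane} (h : triangleArea Γ ≠ 0) {i j i' j' : Fin 3}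
    {s s' : ℝ} (he : (AffineMap.lineMap (Γ i) (Γ j) s : Plane) = AffineMap.lineMap (Γ i') (Γ j') s') :
    edgeWeight i j s = edgeWeight i' j' s' := by
  have c : ∀ (i j : Fin 3) (s : ℝ) (k : Fin 2),
      (AffineMap.lineMap (Γ i) (Γ j) s : Plane) k = ∑ l, edgeWeight i j s l * Γ l k := by
    intro i j s k
    rw [sum_edgeWeight i j s (fun l => Γ l k)]
    simp [AffineMap.lineMap_apply]; ring
  refine weights_unique h ?_ ?_ ?_
  · have := sum_edgeWeight i j s (fun _ => 1)
    have := sum_edgeWeight i' j' s' (fun _ => 1)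
    simp_all
  · rw [← c, ← c, he]
  · rw [← c, ← c, he]

theorem isDrawing_of_triangleArea_ne_zero {Γ : Fin 3 → Plane} (h : triangleArea Γ ≠ 0) :
    IsDrawing (SimpleGraph.cycleGraph 3) Γ where
  vert_injective := by
    intro i j hij
    have hij : Γ i = Γ j := hij
    have := edgeWeight_unique h (i := i) (j := i) (i' := j) (j' := j) (s := 0) (s' := 0)
      (by simp [hij])
    have := congrFun this i
    by_contra hne
    simp [edgeWeight, hne] at this
  edge_ne_vert := by
    intro d s v h0 h1 he
    have hd : d.fst ≠ d.snd := (cycleGraph_three_adj _ _).1 d.adj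
    have := edgeWeight_unique h (i := d.fst) (j := d.snd) (i' := v) (j' := v) (s := s) (s' := 0)
      (by simpa [straightLine] using he)
    have h0 : 0 < (s : ℝ) := h0
    have h1 : (s : ℝ) < 1 := h1
    have a := congrFun this d.fst
    have b := congrFun this d.snd
    simp only [edgeWeight] at a b
    rw [if_pos trivial, if_neg hd] at a
    rw [if_neg hd.symm, if_pos trivial] at b
    split_ifs at a b <;> linarith
  edge_eq_edge := by
    intro d d' s s' h0 h1 h0' h1' he
    have hd : d.fst ≠ d.snd := (cycleGraph_three_adj _ _).1 d.adj
    have hd' : d'.fst ≠ d'.snd := (cycleGraph_three_adj _ _).1 d'.adj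
    have hw := edgeWeight_unique h (i := d.fst) (j := d.snd) (i' := d'.fst) (j' := d'.snd)
      (s := s) (s' := s') he
    have h0 : 0 < (s : ℝ) := h0
    have h1 : (s : ℝ) < 1 := h1
    have h0' : 0 < (s' : ℝ) := h0'
    have h1' : (s' : ℝ) < 1 := h1'
    have a := congrFun hw d.fst
    have b := congrFun hw d.snd
    simp only [edgeWeight] at a b
    rw [if_pos trivial, if_neg hd] at a
    rw [if_neg hd.symm, if_pos trivial] at b
    by_cases c1 : d.fst = d'.fst
    · have c2 : d.fst ≠ d'.snd := c1 ▸ hd'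
      rw [if_pos c1, if_neg c2] at a
      have c3 : d.snd ≠ d'.fst := c1 ▸ hd.symm
      rw [if_neg c3] at b
      left
      by_cases c4 : d.snd = d'.snd
      · refine ⟨SimpleGraph.Dart.ext _ _ (Prod.ext c1.symm c4.symm), Subtype.ext ?_⟩
        rw [if_pos c4] at b
        linarith
      · rw [if_neg c4] at b; linarith
    · rw [if_neg c1] at a
      by_cases c2 : d.fst = d'.snd
      · rw [if_pos c2] at a
        have c3 : d.snd ≠ d'.snd := c2 ▸ hd.symm
        rw [if_neg c3] at b
        by_cases c4 : d.snd = d'.fst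
        · right
          refine ⟨SimpleGraph.Dart.ext _ _ (Prod.ext c4.symm c2.symm), Subtype.ext ?_⟩
          rw [unitInterval.coe_symm_eq]
          linarith
        · rw [if_neg c4] at b; linarith
      · rw [if_neg c2] at a; linarith

theorem exists_openSegment_of_signedArea_eq_zero {p q r : Plane} (hpq : p ≠ q) (hpr : p ≠ r)
    (hqr : q ≠ r) (h : signedArea p q r = 0) :
    (∃ s : ℝ, 0 < s ∧ s < 1 ∧ AffineMap.lineMap p q s = r) ∨
    (∃ s : ℝ, 0 < s ∧ s < 1 ∧ AffineMap.lineMap q r s = p) ∨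
    (∃ s : ℝ, 0 < s ∧ s < 1 ∧ AffineMap.lineMap r p s = q) := by
  have ht : ∃ t : ℝ, r 0 - p 0 = t * (q 0 - p 0) ∧ r 1 - p 1 = t * (q 1 - p 1) := by
    simp only [signedArea] at h
    by_cases h0 : q 0 - p 0 = 0
    · have h1 : q 1 - p 1 ≠ 0 := fun h1 => hpq (plane_ext (by linarith) (by linarith))
      refine ⟨(r 1 - p 1) / (q 1 - p 1), ?_, by field_simp⟩
      have : r 0 - p 0 = 0 := by
        rw [h0] at h
        have : (q 1 - p 1) * (r 0 - p 0) = 0 := by linarith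
        exact (mul_eq_zero.1 this).resolve_left h1
      rw [h0, this]; simp
    · refine ⟨(r 0 - p 0) / (q 0 - p 0), by field_simp, ?_⟩
      field_simp
      linarith
  obtain ⟨t, h0, h1⟩ := ht
  have ht0 : t ≠ 0 := by
    rintro rfl
    exact hpr (plane_ext (by linarith) (by linarith))
  have ht1 : t ≠ 1 := by
    rintro rfl
    exact hqr (plane_ext (by linarith) (by linarith))
  rcases lt_or_gt_of_ne ht0 with c | c
  · right; left
    have : 0 < 1 - t := by linarith
    refine ⟨1 / (1 - t), by positivity, by rw [div_lt_one this]; linarith, plane_ext ?_ ?_⟩ <;>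
      simp [AffineMap.lineMap_apply] <;> field_simp <;> linarith
  rcases lt_or_gt_of_ne ht1 with c' | c'
  · left
    exact ⟨t, c, c', plane_ext (by simp [AffineMap.lineMap_apply]; linarith)
      (by simp [AffineMap.lineMap_apply]; linarith)⟩
  · right; right
    refine ⟨1 - 1 / t, by rw [sub_pos, div_lt_one c]; exact c', by simp; positivity,
      plane_ext ?_ ?_⟩ <;>
      simp [AffineMap.lineMap_apply] <;> field_simp <;> linarith

theorem IsDrawing.triangleArea_ne_zero {Γ : Fin 3 → Plane}
    (h : IsDrawing (SimpleGraph.cycleGraph 3) Γ) : triangleArea Γ ≠ 0 := by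
  intro h0
  have inj : Function.Injective Γ := h.vert_injective
  have key : ∀ (i k : Fin 3) (s : ℝ), 0 < s → s < 1 →
      (AffineMap.lineMap (Γ i) (Γ (i + 1)) s : Plane) ≠ Γ k := fun i k s hs hs' =>
    h.edge_ne_vert (cycleDart i) ⟨s, hs.le, hs'.le⟩ k hs hs'
  rcases exists_openSegment_of_signedArea_eq_zero (inj.ne (by decide)) (inj.ne (by decide))
    (inj.ne (by decide)) h0 with ⟨s, a, b, c⟩ | ⟨s, a, b, c⟩ | ⟨s, a, b, c⟩
  · exact key 0 2 s a b c
  · exact key 1 0 s a b c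
  · exact key 2 1 s a b c

/-- Nondegenerate triangles whose sides miss `P`. -/
def freeTriangles (P : Finset Plane) : Set (Fin 3 → Plane) :=
  {Γ | triangleArea Γ ≠ 0 ∧ ∀ x ∈ P, ∀ i j, x ∉ segment ℝ (Γ i) (Γ j)}

theorem avoids_iff {Γ : Fin 3 → Plane} {P : Finset Plane} :
    (straightLine (SimpleGraph.cycleGraph 3) Γ).Avoids P ↔
      ∀ x ∈ P, ∀ i j, x ∉ segment ℝ (Γ i) (Γ j) := by
  constructor
  · intro h x hx i j hs
    by_cases hij : i = j
    · subst hij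
      rw [segment_same] at hs
      exact Set.disjoint_left.1 h (Or.inl ⟨i, hs.symm⟩) hx
    · rw [segment_eq_image_lineMap] at hs
      obtain ⟨t, ht, rfl⟩ := hs
      exact h.edge_ne ⟨(i, j), (cycleGraph_three_adj _ _).2 hij⟩ ⟨t, ht⟩ hx rfl
  · intro h
    refine Set.disjoint_left.2 fun x hx hP => ?_
    rcases hx with ⟨i, rfl⟩ | hx
    · exact h _ hP i i (left_mem_segment _ _ _)
    · obtain ⟨d, s, rfl⟩ := Set.mem_iUnion.1 hx
      refine h _ hP d.fst d.snd ?_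
      rw [segment_eq_image_lineMap]
      exact ⟨s, s.2, rfl⟩

theorem not_blocked_of_joinedIn {Γ₁ Γ₂ : Fin 3 → Plane} {P : Finset Plane}
    (h : JoinedIn (freeTriangles P) Γ₁ Γ₂) :
    ¬ Blocked (SimpleGraph.cycleGraph 3) Γ₁ Γ₂ P := by
  obtain ⟨γ, hγ⟩ := h
  exact fun hb => hb ⟨γ, ⟨γ.continuous, γ.source, γ.target,
    fun t => isDrawing_of_triangleArea_ne_zero (hγ t).1⟩, fun t => avoids_iff.2 (hγ t).2⟩

theorem triangleArea_comp_swap (Γ : Fin 3 → Plane) :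
    triangleArea (Γ ∘ Equiv.swap 0 1) = - triangleArea Γ := by
  have e2 : (Equiv.swap (0 : Fin 3) 1) 2 = 2 := rfl
  simp only [triangleArea, Function.comp, Equiv.swap_apply_left, Equiv.swap_apply_right, e2,
    signedArea]
  ring

theorem comp_swap_mem_freeTriangles {Γ : Fin 3 → Plane} {P : Finset Plane}
    (h : Γ ∈ freeTriangles P) : Γ ∘ Equiv.swap 0 1 ∈ freeTriangles P :=
  ⟨by rw [triangleArea_comp_swap]; exact neg_ne_zero.2 h.1, fun x hx _ _ => h.2 x hx _ _⟩

theorem joinedIn_freeTriangles_of_comp {Γ₁ Γ₂ : Fin 3 → Plane} {P : Finset Plane}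
    (h : JoinedIn (freeTriangles P) (Γ₁ ∘ Equiv.swap 0 1) (Γ₂ ∘ Equiv.swap 0 1)) :
    JoinedIn (freeTriangles P) Γ₁ Γ₂ := by
  have := h.map (f := fun Γ : Fin 3 → Plane => Γ ∘ Equiv.swap 0 1) (by fun_prop)
  have e : ∀ Γ : Fin 3 → Plane, (Γ ∘ Equiv.swap 0 1) ∘ Equiv.swap 0 1 = Γ := fun Γ => by
    funext i; simp
  rw [e, e] at this
  refine this.mono ?_
  rintro _ ⟨Γ, hΓ, rfl⟩
  exact comp_swap_mem_freeTriangles hΓ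

/-- Counterclockwise triangles with `A` in the interior and `B` outside. -/
def separatingTriangles (A B : Finset Plane) : Set (Fin 3 → Plane) :=
  {Γ | 0 < triangleArea Γ ∧ (∀ a ∈ A, ∀ i, 0 < signedArea a (Γ i) (Γ (i + 1))) ∧
    ∀ b ∈ B, b ∉ convexHull ℝ (Set.range Γ)}

theorem signedArea_rotate_index (Γ : Fin 3 → Plane) (i : Fin 3) :
    signedArea (Γ i) (Γ (i + 1)) (Γ (i + 2)) = triangleArea Γ := by
  fin_cases i
  · rfl
  · exact signedArea_rotate _ _ _
  · exact (signedArea_rotate _ _ _).trans (signedArea_rotate _ _ _)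

theorem signedArea_combo (a b : ℝ) (hab : a + b = 1) (x y q r : Plane) :
    signedArea (a • x + b • y) q r = a * signedArea x q r + b * signedArea y q r := by
  obtain rfl : b = 1 - a := by linarith
  simp [signedArea]; ring

theorem signedArea_eq_zero_of_mem_segment {x p q : Plane} (h : x ∈ segment ℝ p q) :
    signedArea x p q = 0 := by
  obtain ⟨a, b, -, -, hab, rfl⟩ := h
  rw [signedArea_combo _ _ hab]
  simp only [signedArea]; ring

theorem segment_subset_hull (Γ : Fin 3 → Plane) (i j : Fin 3) :
    segment ℝ (Γ i) (Γ j) ⊆ convexHull ℝ (Set.range Γ) :=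
  (convex_convexHull ℝ _).segment_subset (subset_convexHull ℝ _ ⟨i, rfl⟩)
    (subset_convexHull ℝ _ ⟨j, rfl⟩)

theorem signedArea_nonneg_of_mem_hull {Γ : Fin 3 → Plane} (h : 0 ≤ triangleArea Γ) {x : Plane}
    (hx : x ∈ convexHull ℝ (Set.range Γ)) (i : Fin 3) : 0 ≤ signedArea x (Γ i) (Γ (i + 1)) := by
  have hc : Convex ℝ {x : Plane | 0 ≤ signedArea x (Γ i) (Γ (i + 1))} := by
    intro y hy z hz a b ha hb hab
    simp only [Set.mem_ofPred_eq] at hy hz ⊢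
    rw [signedArea_combo _ _ hab]
    positivity
  refine convexHull_min ?_ hc hx
  rintro _ ⟨j, rfl⟩
  have e : j = i ∨ j = i + 1 ∨ j = i + 2 :=
    (by decide : ∀ i j : Fin 3, j = i ∨ j = i + 1 ∨ j = i + 2) i j
  simp only [Set.mem_ofPred_eq]
  rcases e with rfl | rfl | rfl
  · rw [signedArea_eq_zero_of_mem_segment (left_mem_segment ℝ _ _)]
  · rw [signedArea_eq_zero_of_mem_segment (right_mem_segment ℝ _ _)]
  · rw [← signedArea_rotate, signedArea_rotate_index]; exact h

theorem not_mem_segment_of_inside {Γ : Fin 3 → Plane} {x : Plane}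
    (h : ∀ i, 0 < signedArea x (Γ i) (Γ (i + 1))) (i j : Fin 3) : x ∉ segment ℝ (Γ i) (Γ j) := by
  intro hs
  have e : j = i ∨ j = i + 1 ∨ i = j + 1 :=
    (by decide : ∀ i j : Fin 3, j = i ∨ j = i + 1 ∨ i = j + 1) i j
  rcases e with rfl | rfl | rfl
  · rw [segment_same] at hs
    have := h j
    rw [hs, signedArea_eq_zero_of_mem_segment (left_mem_segment ℝ _ _)] at this
    exact lt_irrefl _ this
  · exact (h i).ne' (signedArea_eq_zero_of_mem_segment hs)
  · rw [segment_symm] at hs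
    exact (h j).ne' (signedArea_eq_zero_of_mem_segment hs)

theorem separatingTriangles_subset (A B : Finset Plane) [DecidableEq Plane] :
    separatingTriangles A B ⊆ freeTriangles (A ∪ B) := by
  rintro Γ ⟨h1, h2, h3⟩
  refine ⟨h1.ne', fun x hx i j hs => ?_⟩
  rcases Finset.mem_union.1 hx with hx | hx
  · exact not_mem_segment_of_inside (h2 x hx) i j hs
  · exact h3 x hx (segment_subset_hull Γ i j hs)

theorem sum_signedArea (Γ : Fin 3 → Plane) (x : Plane) :
    signedArea x (Γ 0) (Γ 1) + signedArea x (Γ 1) (Γ 2) + signedArea x (Γ 2) (Γ 0) =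
      triangleArea Γ := by
  simp only [triangleArea, signedArea]; ring

theorem triangleArea_pos_of_inside {Γ : Fin 3 → Plane} {x : Plane}
    (h : ∀ i, 0 < signedArea x (Γ i) (Γ (i + 1))) : 0 < triangleArea Γ := by
  rw [← sum_signedArea Γ x]
  have := h 0; have := h 1; have := h 2
  simp at *
  linarith!

theorem mem_segment_of_nonneg {p q r x : Plane} (h : 0 < signedArea p q r)
    (h0 : signedArea x p q = 0) (h1 : 0 ≤ signedArea x q r) (h2 : 0 ≤ signedArea x r p) :
    x ∈ segment ℝ p q := by
  have hs : signedArea x p q + signedArea x q r + signedArea x r p = signedArea p q r := by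
    simp only [signedArea]; ring
  refine mem_segment_iff_coord.2 ⟨signedArea x r p / signedArea p q r, by positivity,
    by rw [div_le_one h]; linarith, ?_, ?_⟩
  · field_simp
    have : signedArea x p q * r 0 = 0 := by rw [h0, zero_mul]
    simp only [signedArea] at *
    linear_combination this - h0 * p 0
  · field_simp
    have : signedArea x p q * r 1 = 0 := by rw [h0, zero_mul]
    simp only [signedArea] at *
    linear_combination this - h0 * p 1

theorem mem_separatingTriangles_of_free {Γ : Fin 3 → Plane} {A B P : Finset Plane}
    (hΓ : Γ ∈ freeTriangles P) (hpos : 0 < triangleArea Γ)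
    (hA : ∀ a ∈ A, ∀ i, 0 < signedArea a (Γ i) (Γ (i + 1)))
    (hB : ∀ b ∈ B, b ∈ P ∧ ¬ ∀ i, 0 < signedArea b (Γ i) (Γ (i + 1))) :
    Γ ∈ separatingTriangles A B := by
  refine ⟨hpos, hA, fun b hb hh => (hB b hb).2 fun i => ?_⟩
  have hn := signedArea_nonneg_of_mem_hull hpos.le hh
  refine lt_of_le_of_ne (hn i) fun h0 => ?_
  have e : i + 1 + 1 = i + 2 := (by decide : ∀ i : Fin 3, i + 1 + 1 = i + 2) i
  have e' : i + 2 + 1 = i := (by decide : ∀ i : Fin 3, i + 2 + 1 = i) i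
  refine hΓ.2 b (hB b hb).1 i (i + 1) (mem_segment_of_nonneg (r := Γ (i + 2)) ?_ h0.symm ?_ ?_)
  · rw [signedArea_rotate_index]; exact hpos
  · have := hn (i + 1); rwa [e] at this
  · have := hn (i + 2); rwa [e'] at this

/-- A triangle inside another one still misses what the larger one misses. -/
theorem mem_separatingTriangles_of_subset {Γ Γ' : Fin 3 → Plane} {A B : Finset Plane}
    (hA : A.Nonempty) (hΓ : Γ ∈ separatingTriangles A B)
    (h : ∀ i, Γ' i ∈ convexHull ℝ (Set.range Γ))
    (hin : ∀ a ∈ A, ∀ i, 0 < signedArea a (Γ' i) (Γ' (i + 1))) :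
    Γ' ∈ separatingTriangles A B := by
  obtain ⟨a, ha⟩ := hA
  refine ⟨triangleArea_pos_of_inside (hin a ha), hin, fun b hb hb' => hΓ.2.2 b hb ?_⟩
  exact convexHull_min (by rintro _ ⟨i, rfl⟩; exact h i) (convex_convexHull ℝ _) hb'

/-- The affine function with linear part `w` and constant term `c`. -/
def affineEval (w : ℝ × ℝ) (c : ℝ) (x : Plane) : ℝ := w.1 * x 0 + w.2 * x 1 + c

def planeDet (u v : ℝ × ℝ) : ℝ := u.1 * v.2 - u.2 * v.1

/-- The common zero of two affine functions. -/
noncomputable def lineMeet (u : ℝ × ℝ) (c : ℝ) (v : ℝ × ℝ) (e : ℝ) : Plane :=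
  !₂[(u.2 * e - c * v.2) / planeDet u v, (c * v.1 - u.1 * e) / planeDet u v]

/-- The triangle cut out by the affine functions with linear parts `u`, `v`, `-(u + v)`. -/
noncomputable def triangleOfLines (θ : (ℝ × ℝ) × (ℝ × ℝ) × ℝ × ℝ × ℝ) : Fin 3 → Plane :=
  ![lineMeet (-(θ.1 + θ.2.1)) θ.2.2.2.2 θ.1 θ.2.2.1, lineMeet θ.1 θ.2.2.1 θ.2.1 θ.2.2.2.1,
    lineMeet θ.2.1 θ.2.2.2.1 (-(θ.1 + θ.2.1)) θ.2.2.2.2]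

theorem planeDet_neg_add_left (u v : ℝ × ℝ) : planeDet (-(u + v)) u = planeDet u v := by
  simp [planeDet]; ring

theorem planeDet_neg_add_right (u v : ℝ × ℝ) : planeDet v (-(u + v)) = planeDet u v := by
  simp [planeDet]; ring

theorem signedArea_triangleOfLines (u v : ℝ × ℝ) (c d e : ℝ) (h : planeDet u v ≠ 0) (x : Plane) :
    signedArea x (triangleOfLines (u, v, c, d, e) 0) (triangleOfLines (u, v, c, d, e) 1) =
      affineEval u c x * ((c + d + e) / planeDet u v) ∧
    signedArea x (triangleOfLines (u, v, c, d, e) 1) (triangleOfLines (u, v, c, d, e) 2) =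
      affineEval v d x * ((c + d + e) / planeDet u v) ∧
    signedArea x (triangleOfLines (u, v, c, d, e) 2) (triangleOfLines (u, v, c, d, e) 0) =
      affineEval (-(u + v)) e x * ((c + d + e) / planeDet u v) := by
  obtain ⟨u₁, u₂⟩ := u
  obtain ⟨v₁, v₂⟩ := v
  simp only [triangleOfLines, Matrix.cons_val_zero, Matrix.cons_val_one, Matrix.cons_val,
    lineMeet, planeDet_neg_add_left, planeDet_neg_add_right, signedArea, affineEval, Prod.fst_neg,
    Prod.snd_neg, Prod.fst_add, Prod.snd_add]
  generalize hK : planeDet (u₁, u₂) (v₁, v₂) = K at *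
  simp only [planeDet] at hK
  refine ⟨?_, ?_, ?_⟩ <;> field_simp <;> rw [← hK] <;> ring

theorem triangleOfLines_edges (Γ : Fin 3 → Plane) (h : triangleArea Γ ≠ 0) :
    triangleOfLines ((Γ 0 1 - Γ 1 1, Γ 1 0 - Γ 0 0), (Γ 1 1 - Γ 2 1, Γ 2 0 - Γ 1 0),
      Γ 0 0 * Γ 1 1 - Γ 0 1 * Γ 1 0, Γ 1 0 * Γ 2 1 - Γ 1 1 * Γ 2 0,
      Γ 2 0 * Γ 0 1 - Γ 2 1 * Γ 0 0) = Γ := by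
  have hd : planeDet (Γ 0 1 - Γ 1 1, Γ 1 0 - Γ 0 0) (Γ 1 1 - Γ 2 1, Γ 2 0 - Γ 1 0) =
      triangleArea Γ := by
    simp only [planeDet, triangleArea, signedArea]; ring
  funext i
  fin_cases i <;> refine plane_ext ?_ ?_ <;>
    simp only [triangleOfLines, lineMeet, planeDet_neg_add_left, planeDet_neg_add_right, hd,
      Fin.zero_eta, Fin.mk_one, Fin.reduceFinMk, Matrix.cons_val_zero, Matrix.cons_val_one,
      Matrix.cons_val, PiLp.toLp_apply, Prod.fst_neg,
      Prod.snd_neg, Prod.fst_add, Prod.snd_add] <;>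
    rw [div_eq_iff h] <;> simp only [triangleArea, signedArea] <;> ring

/-- Line data of triangles with `A` inside and the first side separating `A` from `B`. -/
def lineData (A B : Finset Plane) : Set ((ℝ × ℝ) × (ℝ × ℝ) × ℝ × ℝ × ℝ) :=
  {θ | 0 < planeDet θ.1 θ.2.1 ∧ (∀ a ∈ A, 0 < affineEval θ.1 θ.2.2.1 a ∧
    0 < affineEval θ.2.1 θ.2.2.2.1 a ∧ 0 < affineEval (-(θ.1 + θ.2.1)) θ.2.2.2.2 a) ∧
    ∀ b ∈ B, affineEval θ.1 θ.2.2.1 b < 0}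

/-- Triangles with `A` inside whose `i`-th side separates `A` from `B`. -/
def sideSeparating (A B : Finset Plane) (i : Fin 3) : Set (Fin 3 → Plane) :=
  {Γ | (∀ a ∈ A, ∀ i, 0 < signedArea a (Γ i) (Γ (i + 1))) ∧
    ∀ b ∈ B, signedArea b (Γ i) (Γ (i + 1)) < 0}

theorem sideSeparating_subset {A B : Finset Plane} (hA : A.Nonempty) (i : Fin 3) :
    sideSeparating A B i ⊆ separatingTriangles A B := by
  rintro Γ ⟨h1, h2⟩
  obtain ⟨a, ha⟩ := hA
  have h := triangleArea_pos_of_inside (h1 a ha)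
  exact ⟨h, h1, fun b hb hh => (h2 b hb).not_ge (signedArea_nonneg_of_mem_hull h.le hh i)⟩

theorem triangleOfLines_mem {A B : Finset Plane} (hA : A.Nonempty)
    {θ : (ℝ × ℝ) × (ℝ × ℝ) × ℝ × ℝ × ℝ} (hθ : θ ∈ lineData A B) :
    triangleOfLines θ ∈ sideSeparating A B 0 := by
  obtain ⟨u, v, c, d, e⟩ := θ
  obtain ⟨h1, h2, h3⟩ := hθ
  obtain ⟨a, ha⟩ := hA
  simp only at h1 h2 h3
  have hs : 0 < c + d + e := by
    obtain ⟨x, y, z⟩ := h2 a ha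
    have : affineEval u c a + affineEval v d a + affineEval (-(u + v)) e a = c + d + e := by
      simp [affineEval]; ring
    linarith
  have hq : 0 < (c + d + e) / planeDet u v := by positivity
  have key := signedArea_triangleOfLines u v c d e h1.ne'
  refine ⟨fun x hx i => ?_, fun b hb => ?_⟩
  · obtain ⟨f0, f1, f2⟩ := h2 x hx
    fin_cases i
    · exact (key x).1 ▸ mul_pos f0 hq
    · exact (key x).2.1 ▸ mul_pos f1 hq
    · exact (key x).2.2 ▸ mul_pos f2 hq
  · exact (key b).1 ▸ mul_neg_of_neg_of_pos (h3 b hb) hq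

theorem exists_lineData {A B : Finset Plane} (hA : A.Nonempty) {Γ : Fin 3 → Plane}
    (hΓ : Γ ∈ sideSeparating A B 0) : ∃ θ ∈ lineData A B, triangleOfLines θ = Γ := by
  have hpos := (sideSeparating_subset hA 0 hΓ).1
  refine ⟨_, ⟨?_, fun a ha => ?_, fun b hb => ?_⟩, triangleOfLines_edges Γ hpos.ne'⟩
  · refine lt_of_lt_of_eq hpos ?_
    simp only [planeDet, triangleArea, signedArea]; ring
  · have h := hΓ.1 a ha
    refine ⟨lt_of_lt_of_eq (h 0) ?_, lt_of_lt_of_eq (h 1) ?_, lt_of_lt_of_eq (h 2) ?_⟩ <;>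
    · simp [affineEval, signedArea]; ring
  · refine lt_of_eq_of_lt ?_ (hΓ.2 b hb)
    simp [affineEval, signedArea]; ring

theorem continuousOn_triangleOfLines (A B : Finset Plane) :
    ContinuousOn triangleOfLines (lineData A B) := by
  have h0 : ∀ θ ∈ lineData A B, θ.1.1 * θ.2.1.2 - θ.1.2 * θ.2.1.1 ≠ 0 := fun θ h => h.1.ne'
  rw [continuousOn_pi]
  intro i
  fin_cases i <;>
  · simp only [triangleOfLines, lineMeet, planeDet_neg_add_left, planeDet_neg_add_right,
      Fin.zero_eta, Fin.mk_one, Fin.reduceFinMk, Matrix.cons_val_zero, Matrix.cons_val_one,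
      Matrix.cons_val, Prod.fst_neg, Prod.snd_neg, Prod.fst_add, Prod.snd_add]
    simp only [planeDet]
    refine (PiLp.continuous_toLp 2 _).comp_continuousOn (continuousOn_pi.2 fun j => ?_)
    fin_cases j <;> simp <;> fun_prop (disch := assumption)

/-- A constant term making the affine function with linear part `w` positive on `A`. -/
noncomputable def safeConst (A : Finset Plane) (w : ℝ × ℝ) : ℝ :=
  1 + ∑ a ∈ A, |w.1 * a 0 + w.2 * a 1|

theorem affineEval_safeConst_pos {A : Finset Plane} {a : Plane} (ha : a ∈ A) (w w' : ℝ × ℝ)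
    (hw : w' = w ∨ w' = -w) : 0 < affineEval w (safeConst A w') a := by
  have e : safeConst A w' = safeConst A w := by
    rcases hw with rfl | rfl
    · rfl
    · simp only [safeConst, Prod.fst_neg, Prod.snd_neg]
      congr 1
      refine Finset.sum_congr rfl fun x _ => ?_
      rw [← abs_neg]; congr 1; ring
  rw [e]
  have h := Finset.single_le_sum (f := fun a : Plane => |w.1 * a 0 + w.2 * a 1|)
    (fun _ _ => abs_nonneg _) ha
  simp only at h
  have := neg_abs_le (w.1 * a 0 + w.2 * a 1)
  simp only [affineEval, safeConst]
  linarith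

theorem continuous_safeConst (A : Finset Plane) : Continuous (safeConst A) := by
  unfold safeConst; fun_prop

/-- The affine functions positive on `A` and negative on `B`. -/
def separatingLines (A B : Finset Plane) : Set ((ℝ × ℝ) × ℝ) :=
  {f | f.1 ≠ 0 ∧ (∀ a ∈ A, 0 < affineEval f.1 f.2 a) ∧ ∀ b ∈ B, affineEval f.1 f.2 b < 0}

noncomputable def standardLineData (A : Finset Plane) (f : (ℝ × ℝ) × ℝ) :
    (ℝ × ℝ) × (ℝ × ℝ) × ℝ × ℝ × ℝ :=
  (f.1, (-f.1.2, f.1.1), f.2, safeConst A (-f.1.2, f.1.1), safeConst A (f.1 + (-f.1.2, f.1.1)))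

theorem planeDet_rotate_pos {u : ℝ × ℝ} (h : u ≠ 0) : 0 < planeDet u (-u.2, u.1) := by
  simp only [planeDet]
  by_cases h1 : u.1 = 0
  · have : u.2 ≠ 0 := fun h2 => h (Prod.ext h1 h2)
    have := mul_self_pos.2 this
    nlinarith [mul_self_nonneg u.1]
  · have := mul_self_pos.2 h1
    nlinarith [mul_self_nonneg u.2]

theorem lineData_safe_mem {A B : Finset Plane} {f : (ℝ × ℝ) × ℝ} (hf : f ∈ separatingLines A B)
    {v : ℝ × ℝ} (hv : 0 < planeDet f.1 v) :
    (f.1, v, f.2, safeConst A v, safeConst A (f.1 + v)) ∈ lineData A B :=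
  ⟨hv, fun _ ha => ⟨hf.2.1 _ ha, affineEval_safeConst_pos ha _ _ (Or.inl rfl),
    affineEval_safeConst_pos ha _ _ (Or.inr (neg_neg _).symm)⟩, hf.2.2⟩

theorem fst_mem_separatingLines {A B : Finset Plane} {θ : (ℝ × ℝ) × (ℝ × ℝ) × ℝ × ℝ × ℝ}
    (hθ : θ ∈ lineData A B) : (θ.1, θ.2.2.1) ∈ separatingLines A B := by
  refine ⟨fun h0 => ?_, fun a ha => (hθ.2.1 a ha).1, hθ.2.2⟩
  have := hθ.1
  simp only at h0
  rw [h0] at this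
  simp [planeDet] at this

theorem affineEval_mix (w : ℝ × ℝ) (c c' t : ℝ) (x : Plane) :
    affineEval w ((1 - t) * c + t * c') x =
      (1 - t) * affineEval w c x + t * affineEval w c' x := by
  simp only [affineEval]; ring

theorem mix_pos {x y t : ℝ} (hx : 0 < x) (hy : 0 < y) (ht : t ∈ Set.Icc (0 : ℝ) 1) :
    0 < (1 - t) * x + t * y := by
  rcases eq_or_lt_of_le ht.1 with h | h
  · rw [← h]; linarith
  · have := mul_pos h hy
    have := mul_nonneg (sub_nonneg.2 ht.2) hx.le
    linarith

theorem joinedIn_standardLineData {A B : Finset Plane} {θ : (ℝ × ℝ) × (ℝ × ℝ) × ℝ × ℝ × ℝ}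
    (hθ : θ ∈ lineData A B) :
    JoinedIn (lineData A B) θ (standardLineData A (θ.1, θ.2.2.1)) := by
  have hf := fst_mem_separatingLines hθ
  obtain ⟨u, v, c, d, e⟩ := θ
  have hc := continuous_safeConst A
  have s1 : JoinedIn (lineData A B) (u, v, c, d, e)
      (u, v, c, safeConst A v, safeConst A (u + v)) := by
    refine JoinedIn.ofLine (f := fun t : ℝ => (u, v, c, (1 - t) * d + t * safeConst A v,
      (1 - t) * e + t * safeConst A (u + v))) (by fun_prop) (by simp) (by simp) ?_
    rintro _ ⟨t, ht, rfl⟩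
    refine ⟨hθ.1, fun a ha => ⟨(hθ.2.1 a ha).1, ?_, ?_⟩, hθ.2.2⟩
    · exact affineEval_mix _ _ _ _ _ ▸ mix_pos (hθ.2.1 a ha).2.1
        (affineEval_safeConst_pos ha _ _ (Or.inl rfl)) ht
    · exact affineEval_mix _ _ _ _ _ ▸ mix_pos (hθ.2.1 a ha).2.2
        (affineEval_safeConst_pos ha _ _ (Or.inr (neg_neg _).symm)) ht
  refine s1.trans (JoinedIn.ofLine (f := fun t : ℝ => (u, (1 - t) • v + t • (-u.2, u.1), c,
    safeConst A ((1 - t) • v + t • (-u.2, u.1)),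
    safeConst A (u + ((1 - t) • v + t • (-u.2, u.1))))) (by fun_prop) (by simp)
    (by simp [standardLineData]) ?_)
  rintro _ ⟨t, ht, rfl⟩
  refine lineData_safe_mem hf ?_
  have : planeDet u ((1 - t) • v + t • (-u.2, u.1)) =
      (1 - t) * planeDet u v + t * planeDet u (-u.2, u.1) := by
    simp [planeDet]; ring
  rw [this]
  exact mix_pos hθ.1 (planeDet_rotate_pos hf.1) ht

theorem joinedIn_sideSeparating_of_lines {A B : Finset Plane} (hA : A.Nonempty)
    (hlines : ∀ f ∈ separatingLines A B, ∀ f' ∈ separatingLines A B,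
      JoinedIn (separatingLines A B) f f')
    {Γ Γ' : Fin 3 → Plane} (hΓ : Γ ∈ sideSeparating A B 0) (hΓ' : Γ' ∈ sideSeparating A B 0) :
    JoinedIn (sideSeparating A B 0) Γ Γ' := by
  obtain ⟨θ, hθ, rfl⟩ := exists_lineData hA hΓ
  obtain ⟨θ', hθ', rfl⟩ := exists_lineData hA hΓ'
  have hc := continuous_safeConst A
  have h1 := (hlines _ (fst_mem_separatingLines hθ) _ (fst_mem_separatingLines hθ')).map
    (f := standardLineData A) (by unfold standardLineData; fun_prop)
  have h2 : JoinedIn (lineData A B) (standardLineData A (θ.1, θ.2.2.1))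
      (standardLineData A (θ'.1, θ'.2.2.1)) := by
    refine h1.mono ?_
    rintro _ ⟨f, hf, rfl⟩
    exact lineData_safe_mem hf (planeDet_rotate_pos hf.1)
  have h3 := ((joinedIn_standardLineData hθ).trans h2).trans (joinedIn_standardLineData hθ').symm
  refine (h3.map_continuousOn (continuousOn_triangleOfLines A B)).mono ?_
  rintro _ ⟨θ, hθ, rfl⟩
  exact triangleOfLines_mem hA hθ

theorem joinedIn_separatingLines {A B : Finset Plane} (hA : A.Nonempty) (hB : B.Nonempty)
    {f f' : (ℝ × ℝ) × ℝ} (hf : f ∈ separatingLines A B) (hf' : f' ∈ separatingLines A B) :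
    JoinedIn (separatingLines A B) f f' := by
  refine JoinedIn.ofLine (f := fun t : ℝ => (1 - t) • f + t • f') (by fun_prop) (by simp)
    (by simp) ?_
  rintro _ ⟨t, ht, rfl⟩
  have e : ∀ x : Plane, affineEval ((1 - t) • f + t • f').1 ((1 - t) • f + t • f').2 x =
      (1 - t) * affineEval f.1 f.2 x + t * affineEval f'.1 f'.2 x := fun x => by
    simp [affineEval]; ring
  have h1 : ∀ a ∈ A, 0 < affineEval ((1 - t) • f + t • f').1 ((1 - t) • f + t • f').2 a :=
    fun a ha => e a ▸ mix_pos (hf.2.1 a ha) (hf'.2.1 a ha) ht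
  have h2 : ∀ b ∈ B, affineEval ((1 - t) • f + t • f').1 ((1 - t) • f + t • f').2 b < 0 := by
    intro b hb
    have := mix_pos (neg_pos.2 (hf.2.2 b hb)) (neg_pos.2 (hf'.2.2 b hb)) ht
    rw [e]; linarith
  refine ⟨fun h0 => ?_, h1, h2⟩
  obtain ⟨a, ha⟩ := hA
  obtain ⟨b, hb⟩ := hB
  have i1 := h1 a ha
  have i2 := h2 b hb
  rw [h0] at i1 i2
  simp only [affineEval, Prod.fst_zero, Prod.snd_zero] at i1 i2
  linarith

theorem joinedIn_separatingLines_empty (A : Finset Plane)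
    {f f' : (ℝ × ℝ) × ℝ} (hf : f ∈ separatingLines A ∅) (hf' : f' ∈ separatingLines A ∅) :
    JoinedIn (separatingLines A ∅) f f' := by
  have hc := continuous_safeConst A
  have s1 : ∀ f ∈ separatingLines A ∅,
      JoinedIn (separatingLines A ∅) f (f.1, safeConst A f.1) := by
    intro f hf
    refine JoinedIn.ofLine (f := fun t : ℝ => (f.1, (1 - t) * f.2 + t * safeConst A f.1))
      (by fun_prop) (by simp) (by simp) ?_
    rintro _ ⟨t, ht, rfl⟩
    refine ⟨hf.1, fun a ha => ?_, by simp⟩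
    exact affineEval_mix _ _ _ _ _ ▸ mix_pos (hf.2.1 a ha)
      (affineEval_safeConst_pos ha _ _ (Or.inl rfl)) ht
  have s2 : JoinedIn ({0}ᶜ : Set (ℝ × ℝ)) f.1 f'.1 :=
    (isPathConnected_compl_singleton_of_one_lt_rank (by
      rw [← Module.finrank_eq_rank, Module.finrank_prod, Module.finrank_self]; norm_num)
      (0 : ℝ × ℝ)).joinedIn _ hf.1 _ hf'.1
  have s3 := s2.map (f := fun w => (w, safeConst A w)) (by fun_prop)
  refine ((s1 f hf).trans (s3.mono ?_)).trans (s1 f' hf').symm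
  rintro _ ⟨w, hw, rfl⟩
  exact ⟨hw, fun a ha => affineEval_safeConst_pos ha _ _ (Or.inl rfl), by simp⟩

/-- Triangles containing `A` form a connected space. -/
theorem joinedIn_of_no_outside {A : Finset Plane} (hA : A.Nonempty) {Γ Γ' : Fin 3 → Plane}
    (hΓ : Γ ∈ separatingTriangles A ∅) (hΓ' : Γ' ∈ separatingTriangles A ∅) :
    JoinedIn (separatingTriangles A ∅) Γ Γ' :=
  (joinedIn_sideSeparating_of_lines hA (fun _ hf _ hf' => joinedIn_separatingLines_empty A hf hf')
    ⟨hΓ.2.1, by simp⟩ ⟨hΓ'.2.1, by simp⟩).mono (sideSeparating_subset hA 0)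

theorem rotate_mem_sideSeparating {A B : Finset Plane} {Γ : Fin 3 → Plane} {i : Fin 3} (j : Fin 3)
    (h : Γ ∈ sideSeparating A B (i + j)) : (fun k => Γ (k + j)) ∈ sideSeparating A B i := by
  have e : ∀ k : Fin 3, k + 1 + j = k + j + 1 := fun k => add_right_comm k 1 j
  refine ⟨fun a ha k => ?_, fun b hb => ?_⟩
  · simp only [e]; exact h.1 a ha _
  · simp only [e]; exact h.2 b hb

theorem joinedIn_sideSeparating {A B : Finset Plane} (hA : A.Nonempty) (hB : B.Nonempty) (i : Fin 3)
    {Γ Γ' : Fin 3 → Plane} (hΓ : Γ ∈ sideSeparating A B i) (hΓ' : Γ' ∈ sideSeparating A B i) :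
    JoinedIn (sideSeparating A B i) Γ Γ' := by
  have h1 : ∀ Γ ∈ sideSeparating A B i, (fun k => Γ (k + i)) ∈ sideSeparating A B 0 :=
    fun Γ h => rotate_mem_sideSeparating i (by rwa [zero_add])
  have h := joinedIn_sideSeparating_of_lines hA
    (fun _ hf _ hf' => joinedIn_separatingLines hA hB hf hf') (h1 Γ hΓ) (h1 Γ' hΓ')
  have h2 := h.map (f := fun Γ : Fin 3 → Plane => fun k => Γ (k + -i)) (by fun_prop)
  have e : ∀ Γ : Fin 3 → Plane, (fun k => Γ (k + -i + i)) = Γ := fun Γ => by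
    funext k; rw [neg_add_cancel_right]
  simp only [e] at h2
  refine h2.mono ?_
  rintro _ ⟨Γ, hΓ, rfl⟩
  exact rotate_mem_sideSeparating (-i) (by rwa [add_neg_cancel])

theorem exists_mem_two_sideSeparating {A B : Finset Plane} (hA : A.Nonempty)
    {f : (ℝ × ℝ) × ℝ} (hf : f ∈ separatingLines A B) :
    ∃ Γ, Γ ∈ sideSeparating A B 0 ∧ Γ ∈ sideSeparating A B 1 := by
  have hcont : ∀ x : Plane, Continuous fun ε : ℝ =>
      affineEval (f.1 + ε • (-f.1.2, f.1.1)) f.2 x := fun x => by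
    unfold affineEval; fun_prop
  have h0 : ∀ x : Plane, affineEval (f.1 + (0 : ℝ) • (-f.1.2, f.1.1)) f.2 x =
    affineEval f.1 f.2 x := fun x => by simp
  have e1 : ∀ᶠ ε : ℝ in nhds 0, ∀ a ∈ A, 0 < affineEval (f.1 + ε • (-f.1.2, f.1.1)) f.2 a := by
    rw [Filter.eventually_all_finset]
    exact fun a ha => (hcont a).continuousAt.eventually_const_lt (by simp only [h0]; exact hf.2.1 a ha)
  have e2 : ∀ᶠ ε : ℝ in nhds 0, ∀ b ∈ B, affineEval (f.1 + ε • (-f.1.2, f.1.1)) f.2 b < 0 := by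
    rw [Filter.eventually_all_finset]
    exact fun b hb => (hcont b).continuousAt.eventually_lt_const (by simp only [h0]; exact hf.2.2 b hb)
  obtain ⟨ε, ⟨hε1, hε2⟩, hε⟩ := (((e1.and e2).filter_mono nhdsWithin_le_nhds).and
    (self_mem_nhdsWithin (s := Set.Ioi (0 : ℝ)))).exists
  set v := f.1 + ε • (-f.1.2, f.1.1) with hv
  have hd : 0 < planeDet f.1 v := by
    have : planeDet f.1 v = ε * planeDet f.1 (-f.1.2, f.1.1) := by
      simp [hv, planeDet]; ring
    rw [this]; exact mul_pos hε (planeDet_rotate_pos hf.1)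
  have hθ : (f.1, v, f.2, f.2, safeConst A (f.1 + v)) ∈ lineData A B :=
    ⟨hd, fun a ha => ⟨hf.2.1 a ha, hε1 a ha,
      affineEval_safeConst_pos ha _ _ (Or.inr (neg_neg _).symm)⟩, hf.2.2⟩
  have hm := triangleOfLines_mem hA hθ
  refine ⟨_, hm, hm.1, fun b hb => ?_⟩
  obtain ⟨a, ha⟩ := hA
  have k0 := signedArea_triangleOfLines f.1 v f.2 f.2 (safeConst A (f.1 + v)) hd.ne'
  have hq : 0 < (f.2 + f.2 + safeConst A (f.1 + v)) / planeDet f.1 v := by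
    have := hm.1 a ha 0
    rw [zero_add, (k0 a).1] at this
    exact (mul_pos_iff_of_pos_left (hf.2.1 a ha)).1 this
  exact (k0 b).2.1 ▸ mul_neg_of_neg_of_pos (hε2 b hb) hq

theorem exists_mem_adjacent_sideSeparating {A B : Finset Plane} (hA : A.Nonempty) {i : Fin 3}
    {Γ : Fin 3 → Plane} (hΓ : Γ ∈ sideSeparating A B i) (j : Fin 3) :
    ∃ Γ', Γ' ∈ sideSeparating A B j ∧ Γ' ∈ sideSeparating A B (j + 1) := by
  obtain ⟨θ, hθ, -⟩ := exists_lineData hA (rotate_mem_sideSeparating i (by rwa [zero_add]))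
  obtain ⟨Γ', h0, h1⟩ := exists_mem_two_sideSeparating hA (fst_mem_separatingLines hθ)
  refine ⟨fun k => Γ' (k + -j), rotate_mem_sideSeparating _ (by rwa [add_neg_cancel]),
    rotate_mem_sideSeparating _ ?_⟩
  have : j + 1 + -j = 1 := by rw [add_comm j 1, add_neg_cancel_right]
  rwa [this]

theorem mem_hull_of_signedArea_nonneg {Γ : Fin 3 → Plane} {x : Plane} (h : 0 < triangleArea Γ)
    (hx : ∀ i, 0 ≤ signedArea x (Γ i) (Γ (i + 1))) : x ∈ convexHull ℝ (Set.range Γ) := by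
  have hs := sum_signedArea Γ x
  have h0 : 0 ≤ signedArea x (Γ 0) (Γ 1) := hx 0
  have h1 : 0 ≤ signedArea x (Γ 1) (Γ 2) := hx 1
  have h2 : 0 ≤ signedArea x (Γ 2) (Γ 0) := hx 2
  have hm := (convex_convexHull ℝ (Set.range Γ)).sum_mem (t := Finset.univ)
    (w := ![signedArea x (Γ 1) (Γ 2) / triangleArea Γ, signedArea x (Γ 2) (Γ 0) / triangleArea Γ,
      signedArea x (Γ 0) (Γ 1) / triangleArea Γ]) (z := Γ) ?_ ?_
    (fun i _ => subset_convexHull ℝ _ ⟨i, rfl⟩)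
  · convert hm using 1
    rw [Fin.sum_univ_three]
    refine plane_ext ?_ ?_ <;> simp <;> field_simp <;> simp only [triangleArea, signedArea] <;> ring
  · intro i _
    fin_cases i <;> simp <;> positivity
  · rw [Fin.sum_univ_three]
    simp
    field_simp
    linarith

/-- With at least one point inside and one point outside, the space of triangles is connected. -/
theorem joinedIn_of_one_outside {A : Finset Plane} (hA : A.Nonempty) (b : Plane)
    {Γ Γ' : Fin 3 → Plane} (hΓ : Γ ∈ separatingTriangles A {b})
    (hΓ' : Γ' ∈ separatingTriangles A {b}) : JoinedIn (separatingTriangles A {b}) Γ Γ' := by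
  have key : ∀ Γ ∈ separatingTriangles A {b}, ∃ i, Γ ∈ sideSeparating A {b} i := by
    intro Γ hΓ
    by_contra! hcon
    refine hΓ.2.2 b (by simp) (mem_hull_of_signedArea_nonneg hΓ.1 fun i => not_lt.1 fun h => ?_)
    exact hcon i ⟨hΓ.2.1, by simpa using h⟩
  obtain ⟨i, hi⟩ := key Γ hΓ
  obtain ⟨j, hj⟩ := key Γ' hΓ'
  have hB : ({b} : Finset Plane).Nonempty := by simp
  have step : ∀ i j (Γ Γ' : Fin 3 → Plane), Γ ∈ sideSeparating A {b} i →
      Γ' ∈ sideSeparating A {b} j → j = i + 1 → JoinedIn (separatingTriangles A {b}) Γ Γ' := by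
    rintro i _ Γ Γ' hi hj rfl
    obtain ⟨Γ'', h0, h1⟩ := exists_mem_adjacent_sideSeparating hA hi i
    exact ((joinedIn_sideSeparating hA hB i hi h0).mono (sideSeparating_subset hA _)).trans
      ((joinedIn_sideSeparating hA hB _ h1 hj).mono (sideSeparating_subset hA _))
  have e : j = i ∨ j = i + 1 ∨ i = j + 1 :=
    (by decide : ∀ i j : Fin 3, j = i ∨ j = i + 1 ∨ i = j + 1) i j
  rcases e with rfl | h | h
  · exact (joinedIn_sideSeparating hA hB _ hi hj).mono (sideSeparating_subset hA _)
  · exact step i j _ _ hi hj h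
  · exact (step j i _ _ hj hi h).symm

noncomputable def scaleAbout (c : Plane) (l : ℝ) (Γ : Fin 3 → Plane) : Fin 3 → Plane :=
  fun i => c + l • (Γ i - c)

theorem signedArea_translate_scale (c c' : Plane) (l : ℝ) (p q : Plane) :
    signedArea c' (c' + l • (p - c)) (c' + l • (q - c)) = l ^ 2 * signedArea c p q := by
  simp [signedArea]; ring

theorem not_mem_hull_of_dist_lt {Γ : Fin 3 → Plane} {c b : Plane} {δ : ℝ}
    (h : ∀ i, dist (Γ i) c < δ) (hb : δ ≤ dist b c) : b ∉ convexHull ℝ (Set.range Γ) := by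
  intro hh
  have : b ∈ Metric.ball c δ := convexHull_min
    (by rintro _ ⟨i, rfl⟩; exact h i) (convex_ball c δ) hh
  exact absurd (Metric.mem_ball.1 this) (not_lt.2 hb)

theorem mem_of_dist_lt {Γ : Fin 3 → Plane} {c : Plane} {B : Finset Plane} {δ : ℝ}
    (h0 : ∀ i, 0 < signedArea c (Γ i) (Γ (i + 1))) (h : ∀ i, dist (Γ i) c < δ)
    (hB : ∀ b ∈ B, δ ≤ dist b c) : Γ ∈ separatingTriangles {c} B :=
  ⟨triangleArea_pos_of_inside h0, by simpa using h0,
    fun b hb => not_mem_hull_of_dist_lt h (hB b hb)⟩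

theorem separatingTriangles_anti {A A' B B' : Finset Plane} (hA : A' ⊆ A) (hB : B' ⊆ B) :
    separatingTriangles A B ⊆ separatingTriangles A' B' :=
  fun _ h => ⟨h.1, fun a ha => h.2.1 a (hA ha), fun b hb => h.2.2 b (hB hb)⟩

theorem mem_hull_of_inside {Γ : Fin 3 → Plane} {x : Plane}
    (h : ∀ i, 0 < signedArea x (Γ i) (Γ (i + 1))) : x ∈ convexHull ℝ (Set.range Γ) :=
  mem_hull_of_signedArea_nonneg (triangleArea_pos_of_inside h) fun i => (h i).le

theorem joinedIn_scaleAbout {c : Plane} {B : Finset Plane} {Γ : Fin 3 → Plane}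
    (hΓ : Γ ∈ separatingTriangles {c} B) {l : ℝ} (hl : 0 < l) (hl1 : l ≤ 1) :
    JoinedIn (separatingTriangles {c} B) Γ (scaleAbout c l Γ) := by
  have hin := hΓ.2.1 c (by simp)
  refine JoinedIn.ofLine (f := fun t : ℝ => scaleAbout c (1 - t + t * l) Γ)
    (by unfold scaleAbout; fun_prop) (by funext i; simp [scaleAbout])
    (by simp) ?_
  rintro _ ⟨t, ht, rfl⟩
  have h0 : 0 < 1 - t + t * l := by
    have := mix_pos one_pos hl ht
    linarith
  have h1 : 1 - t + t * l ≤ 1 := by nlinarith [ht.1]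
  refine mem_separatingTriangles_of_subset (by simp) hΓ (fun i => ?_) ?_
  · have := (convex_convexHull ℝ (Set.range Γ)) (mem_hull_of_inside hin)
      (subset_convexHull ℝ _ ⟨i, rfl⟩) (sub_nonneg.2 h1) h0.le (by ring)
    convert this using 1
    simp only [scaleAbout]; module
  · simp only [Finset.mem_singleton, forall_eq]
    intro i
    simp only [scaleAbout]
    rw [signedArea_translate_scale]
    exact mul_pos (by positivity) (hin i)

theorem exists_scale_lt {R δ : ℝ} (hδ : 0 < δ) : ∃ l : ℝ, 0 < l ∧ l ≤ 1 ∧ l * R < δ := by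
  refine ⟨min 1 (δ / (2 * (|R| + 1))), lt_min one_pos (by positivity), min_le_left _ _, ?_⟩
  have h1 : min 1 (δ / (2 * (|R| + 1))) * R ≤ δ / (2 * (|R| + 1)) * |R| :=
    (mul_le_mul_of_nonneg_left (le_abs_self R) (le_min zero_le_one (by positivity))).trans
      (mul_le_mul_of_nonneg_right (min_le_right _ _) (abs_nonneg R))
  refine h1.trans_lt ?_
  rw [div_mul_eq_mul_div, div_lt_iff₀ (by positivity)]
  nlinarith [abs_nonneg R]

theorem exists_pos_le_dist {K : Set Plane} (hK : IsCompact K) (B : Finset Plane)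
    (hd : ∀ b ∈ B, b ∉ K) : ∃ δ > 0, ∀ x ∈ K, ∀ b ∈ B, δ ≤ dist b x := by
  obtain ⟨δ, hδ, h⟩ := Disjoint.exists_thickenings (s := K) (t := (B : Set Plane))
    (Set.disjoint_left.2 fun x hx hB => hd x hB hx) hK B.finite_toSet.isClosed
  refine ⟨δ, hδ, fun x hx b hb => ?_⟩
  by_contra! hlt
  exact Set.disjoint_left.1 h (Metric.mem_thickening_iff.2 ⟨x, hx, hlt⟩)
    (Metric.self_subset_thickening hδ _ hb)

/-- Triangles around a single point form a connected space, whatever lies outside. -/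
theorem joinedIn_of_one_inside {c : Plane} {B : Finset Plane} {Γ Γ' : Fin 3 → Plane}
    (hΓ : Γ ∈ separatingTriangles {c} B) (hΓ' : Γ' ∈ separatingTriangles {c} B) :
    JoinedIn (separatingTriangles {c} B) Γ Γ' := by
  have hcB : ∀ b ∈ B, b ∉ ({c} : Set Plane) := by
    rintro b hb rfl
    exact hΓ.2.2 b hb (mem_hull_of_inside (hΓ.2.1 b (by simp)))
  obtain ⟨δ, hδ, hdist⟩ := exists_pos_le_dist isCompact_singleton B hcB
  obtain ⟨γ, hγ⟩ := joinedIn_of_no_outside (A := {c}) (by simp)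
    (separatingTriangles_anti le_rfl (Finset.empty_subset B) hΓ)
    (separatingTriangles_anti le_rfl (Finset.empty_subset B) hΓ')
  have hbd : ∃ R, ∀ t i, dist (γ t i) c ≤ R := by
    have : IsCompact (Set.range fun p : unitInterval × Fin 3 => dist (γ p.1 p.2) c) :=
      isCompact_range (by
        refine Continuous.dist ?_ continuous_const
        exact continuous_prod_of_discrete_right.2 fun i =>
          (continuous_apply i).comp γ.continuous)
    obtain ⟨R, hR⟩ := this.bddAbove
    exact ⟨R, fun t i => hR ⟨(t, i), rfl⟩⟩
  obtain ⟨R, hR⟩ := hbd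
  obtain ⟨l, hl, hl1, hlR⟩ := exists_scale_lt (R := R) hδ
  have h2 : JoinedIn (separatingTriangles {c} B) (scaleAbout c l Γ) (scaleAbout c l Γ') := by
    refine ⟨(γ.map (f := scaleAbout c l) (by unfold scaleAbout; fun_prop)), fun t => ?_⟩
    refine mem_of_dist_lt (δ := δ) (fun i => ?_) (fun i => ?_) (fun b hb => hdist c rfl b hb)
    · simp only [Path.map_coe, Function.comp, scaleAbout]
      rw [signedArea_translate_scale]
      exact mul_pos (by positivity) ((hγ t).2.1 c (by simp) i)
    · simp only [Path.map_coe, Function.comp, scaleAbout]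
      rw [dist_eq_norm, add_sub_cancel_left, norm_smul, ← dist_eq_norm, Real.norm_of_nonneg hl.le]
      exact (mul_le_mul_of_nonneg_left (hR t i) hl.le).trans_lt hlR
  exact ((joinedIn_scaleAbout hΓ hl hl1).trans h2).trans (joinedIn_scaleAbout hΓ' hl hl1).symm

theorem exists_inside {Γ : Fin 3 → Plane} (h : 0 < triangleArea Γ) :
    ∃ c, ∀ i, 0 < signedArea c (Γ i) (Γ (i + 1)) := by
  have e : ∀ i : Fin 3, signedArea ((1 / 3 : ℝ) • (Γ 0 + Γ 1 + Γ 2)) (Γ i) (Γ (i + 1)) =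
      triangleArea Γ / 3 := by
    intro i
    fin_cases i <;> simp [signedArea, triangleArea] <;> ring
  exact ⟨_, fun i => by rw [e]; positivity⟩

/-- Triangles with nothing inside form a connected space. -/
theorem joinedIn_of_none_inside {B : Finset Plane} {Γ Γ' : Fin 3 → Plane}
    (hΓ : Γ ∈ separatingTriangles ∅ B) (hΓ' : Γ' ∈ separatingTriangles ∅ B) :
    JoinedIn (separatingTriangles ∅ B) Γ Γ' := by
  obtain ⟨c, hc⟩ := exists_inside hΓ.1
  obtain ⟨c', hc'⟩ := exists_inside hΓ'.1
  have m : Γ ∈ separatingTriangles {c} B := ⟨hΓ.1, by simpa using hc, hΓ.2.2⟩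
  have m' : Γ' ∈ separatingTriangles {c'} B := ⟨hΓ'.1, by simpa using hc', hΓ'.2.2⟩
  have hpath : JoinedIn ((B : Set Plane)ᶜ) c c' :=
    (B.countable_toSet.isPathConnected_compl_of_one_lt_rank (by
      rw [← Module.finrank_eq_rank, finrank_euclideanSpace_fin]; norm_num)).joinedIn _
      (fun hb => hΓ.2.2 c hb (mem_hull_of_inside hc)) _
      (fun hb => hΓ'.2.2 c' hb (mem_hull_of_inside hc'))
  obtain ⟨γ, hγ⟩ := hpath
  obtain ⟨δ, hδ, hdist⟩ := exists_pos_le_dist (isCompact_range γ.continuous) B (by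
    rintro b hb ⟨t, rfl⟩
    exact hγ t hb)
  obtain ⟨R, hR⟩ : ∃ R, ∀ i, dist (Γ i) c ≤ R := by
    obtain ⟨R, hR⟩ := (Set.finite_range fun i => dist (Γ i) c).bddAbove
    exact ⟨R, fun i => hR ⟨i, rfl⟩⟩
  obtain ⟨l, hl, hl1, hlR⟩ := exists_scale_lt (R := R) hδ
  have hmem : ∀ t, (fun i => γ t + l • (Γ i - c)) ∈ separatingTriangles {γ t} B := by
    intro t
    refine mem_of_dist_lt (δ := δ) (fun i => ?_) (fun i => ?_)
      (fun b hb => hdist _ ⟨t, rfl⟩ b hb)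
    · rw [signedArea_translate_scale]
      exact mul_pos (by positivity) (hc i)
    · rw [dist_eq_norm, add_sub_cancel_left, norm_smul, ← dist_eq_norm, Real.norm_of_nonneg hl.le]
      exact (mul_le_mul_of_nonneg_left (hR i) hl.le).trans_lt hlR
  have sub : ∀ c, separatingTriangles {c} B ⊆ separatingTriangles ∅ B := fun c =>
    separatingTriangles_anti (Finset.empty_subset _) le_rfl
  have h2 : JoinedIn (separatingTriangles ∅ B) (scaleAbout c l Γ)
      (fun i => c' + l • (Γ i - c)) := by
    exact ⟨γ.map (f := fun x : Plane => fun i => x + l • (Γ i - c)) (by fun_prop),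
      fun t => sub _ (hmem t)⟩
  have m'' := hmem 1
  rw [γ.target] at m''
  exact (((joinedIn_scaleAbout m hl hl1).mono (sub c)).trans h2).trans
    ((joinedIn_of_one_inside m'' m').mono (sub c'))

def planeCross (x y : Plane) : ℝ := x 0 * y 1 - x 1 * y 0

theorem not_mem_hull_of_thickening {Γ : Fin 3 → Plane} {K : Set Plane} (hK : Convex ℝ K) {b : Plane}
    {ρ : ℝ} (h : ∀ i, Γ i ∈ Metric.thickening ρ K) (hb : ∀ x ∈ K, ρ ≤ dist b x) :
    b ∉ convexHull ℝ (Set.range Γ) := by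
  intro hh
  have : b ∈ Metric.thickening ρ K := convexHull_min
    (by rintro _ ⟨i, rfl⟩; exact h i) (hK.thickening ρ) hh
  obtain ⟨x, hx, hlt⟩ := Metric.mem_thickening_iff.1 this
  exact absurd hlt (not_lt.2 (hb x hx))

theorem add_mem_thickening {K : Set Plane} {x y : Plane} {ρ : ℝ} (hx : x ∈ K) (hy : ‖y‖ < ρ) :
    x + y ∈ Metric.thickening ρ K :=
  Metric.mem_thickening_iff.2 ⟨x, hx, by rwa [dist_eq_norm, add_sub_cancel_left]⟩

section TwoInside

variable {a a' : Plane} {B : Finset Plane}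

theorem inside_of_signs {a p q r : Plane} (h0 : 0 < signedArea a p q) (h1 : 0 < signedArea a q r)
    (h2 : 0 < signedArea a r p) (i : Fin 3) :
    0 < signedArea a ((![p, q, r] : Fin 3 → Plane) i) ((![p, q, r] : Fin 3 → Plane) (i + 1)) := by
  fin_cases i
  · exact h0
  · exact h1
  · exact h2

theorem mem_of_inside_pair {A : Finset Plane} (hA : ∀ x, x ∈ A ↔ x = a ∨ x = a') {Γ : Fin 3 → Plane}
    (h : ∀ i, 0 < signedArea a (Γ i) (Γ (i + 1))) (h' : ∀ i, 0 < signedArea a' (Γ i) (Γ (i + 1)))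
    (hB : ∀ b ∈ B, b ∉ convexHull ℝ (Set.range Γ)) : Γ ∈ separatingTriangles A B := by
  refine ⟨triangleArea_pos_of_inside h, fun x hx => ?_, hB⟩
  rcases (hA x).1 hx with rfl | rfl
  · exact h
  · exact h'

/-- Thin triangles around the segment from `a` to `a'`, with two vertices near a point beyond `a`. -/
theorem thin_mem {A : Finset Plane} (hA : ∀ x, x ∈ A ↔ x = a ∨ x = a') {δ ρ : ℝ} (hδ : 0 < δ)
    (hρ0 : 0 < ρ)
    (hρ : ∀ x ∈ segment ℝ (a - δ • (a' - a)) (a' + δ • (a' - a)), ∀ b ∈ B, ρ ≤ dist b x)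
    {P Q : Plane} (hP : 0 < planeCross (a' - a) P) (hQ : planeCross (a' - a) Q < 0)
    (hPQ : 0 ≤ planeCross P Q) (nP : ‖P‖ < ρ) (nQ : ‖Q‖ < ρ) :
    ![a - δ • (a' - a) + P, a - δ • (a' - a) + Q, a' + δ • (a' - a)] ∈
      separatingTriangles A B := by
  refine mem_of_inside_pair hA (inside_of_signs ?_ ?_ ?_) (inside_of_signs ?_ ?_ ?_) ?_
  · have e : signedArea a (a - δ • (a' - a) + P) (a - δ • (a' - a) + Q) = planeCross P Q +
        δ * (planeCross (a' - a) P - planeCross (a' - a) Q) := by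
      simp [signedArea, planeCross]; ring
    rw [e]; nlinarith
  · have e : signedArea a (a - δ • (a' - a) + Q) (a' + δ • (a' - a)) =
        (1 + δ) * -planeCross (a' - a) Q := by
      simp [signedArea, planeCross]; ring
    rw [e]; exact mul_pos (by linarith) (by linarith)
  · have e : signedArea a (a' + δ • (a' - a)) (a - δ • (a' - a) + P) =
        (1 + δ) * planeCross (a' - a) P := by
      simp [signedArea, planeCross]; ring
    rw [e]; exact mul_pos (by linarith) hP
  · have e : signedArea a' (a - δ • (a' - a) + P) (a - δ • (a' - a) + Q) = planeCross P Q +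
        (1 + δ) * (planeCross (a' - a) P - planeCross (a' - a) Q) := by
      simp [signedArea, planeCross]; ring
    rw [e]; nlinarith
  · have e : signedArea a' (a - δ • (a' - a) + Q) (a' + δ • (a' - a)) =
        δ * -planeCross (a' - a) Q := by
      simp [signedArea, planeCross]; ring
    rw [e]; exact mul_pos hδ (by linarith)
  · have e : signedArea a' (a' + δ • (a' - a)) (a - δ • (a' - a) + P) =
        δ * planeCross (a' - a) P := by
      simp [signedArea, planeCross]; ring
    rw [e]; exact mul_pos hδ hP
  · intro b hb
    refine not_mem_hull_of_thickening (convex_segment _ _) (fun i => ?_) (fun x hx => hρ x hx b hb)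
    fin_cases i
    · exact add_mem_thickening (left_mem_segment _ _ _) nP
    · exact add_mem_thickening (left_mem_segment _ _ _) nQ
    · exact Metric.self_subset_thickening hρ0 _ (right_mem_segment _ _ _)

theorem planeCross_mix_right (u x y : Plane) (t : ℝ) :
    planeCross u ((1 - t) • x + t • y) = (1 - t) * planeCross u x + t * planeCross u y := by
  simp [planeCross]; ring

theorem norm_mix_lt {x y : Plane} {t ρ : ℝ} (hx : ‖x‖ < ρ) (hy : ‖y‖ < ρ)
    (ht : t ∈ Set.Icc (0 : ℝ) 1) : ‖(1 - t) • x + t • y‖ < ρ := by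
  have := (convex_ball (0 : Plane) ρ) (mem_ball_zero_iff.2 hx) (mem_ball_zero_iff.2 hy)
    (sub_nonneg.2 ht.2) ht.1 (by ring)
  exact mem_ball_zero_iff.1 this

theorem continuous_triple {X : Type*} [TopologicalSpace X] {f g h : X → Plane} (hf : Continuous f)
    (hg : Continuous g) (hh : Continuous h) :
    Continuous fun x => (![f x, g x, h x] : Fin 3 → Plane) := by
  refine continuous_pi fun i => ?_
  fin_cases i
  · exact hf
  · exact hg
  · exact hh

theorem joinedIn_thin {A : Finset Plane} (hA : ∀ x, x ∈ A ↔ x = a ∨ x = a') {δ ρ : ℝ} (hδ : 0 < δ)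
    (hρ0 : 0 < ρ)
    (hρ : ∀ x ∈ segment ℝ (a - δ • (a' - a)) (a' + δ • (a' - a)), ∀ b ∈ B, ρ ≤ dist b x)
    {P Q P' Q' : Plane} (hP : 0 < planeCross (a' - a) P) (hQ : planeCross (a' - a) Q < 0)
    (hPQ : 0 ≤ planeCross P Q) (nP : ‖P‖ < ρ) (nQ : ‖Q‖ < ρ)
    (hP' : 0 < planeCross (a' - a) P') (hQ' : planeCross (a' - a) Q' < 0)
    (hPQ' : 0 ≤ planeCross P' Q') (nP' : ‖P'‖ < ρ) (nQ' : ‖Q'‖ < ρ) :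
    JoinedIn (separatingTriangles A B)
      ![a - δ • (a' - a) + P, a - δ • (a' - a) + Q, a' + δ • (a' - a)]
      ![a - δ • (a' - a) + P', a - δ • (a' - a) + Q', a' + δ • (a' - a)] := by
  have neg : ∀ x y : Plane, planeCross x (-y) = -planeCross x y := fun x y => by
    simp [planeCross]; ring
  have self : ∀ x : Plane, planeCross x x = 0 := fun x => by simp [planeCross]; ring
  have s1 : ∀ P Q : Plane, 0 < planeCross (a' - a) P → planeCross (a' - a) Q < 0 →
      0 ≤ planeCross P Q → ‖P‖ < ρ → ‖Q‖ < ρ → JoinedIn (separatingTriangles A B)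
      ![a - δ • (a' - a) + P, a - δ • (a' - a) + Q, a' + δ • (a' - a)]
      ![a - δ • (a' - a) + P, a - δ • (a' - a) + -P, a' + δ • (a' - a)] := by
    intro P Q hP hQ hPQ nP nQ
    refine JoinedIn.ofLine (f := fun t : ℝ => ![a - δ • (a' - a) + P,
      a - δ • (a' - a) + ((1 - t) • Q + t • (-P)), a' + δ • (a' - a)])
      (continuous_triple (by fun_prop) (by fun_prop) (by fun_prop)).continuousOn
      (by simp) (by simp) ?_
    rintro _ ⟨t, ht, rfl⟩
    refine thin_mem hA hδ hρ0 hρ hP ?_ ?_ nP (norm_mix_lt nQ (by rwa [norm_neg]) ht)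
    · have := mix_pos (neg_pos.2 hQ) hP ht
      rw [planeCross_mix_right, neg]; linarith
    · rw [planeCross_mix_right, neg, self]
      have := mul_nonneg (sub_nonneg.2 ht.2) hPQ
      linarith
  refine ((s1 P Q hP hQ hPQ nP nQ).trans ?_).trans (s1 P' Q' hP' hQ' hPQ' nP' nQ').symm
  refine JoinedIn.ofLine (f := fun t : ℝ => ![a - δ • (a' - a) + ((1 - t) • P + t • P'),
      a - δ • (a' - a) + -((1 - t) • P + t • P'), a' + δ • (a' - a)])
      (continuous_triple (by fun_prop) (by fun_prop) (by fun_prop)).continuousOn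
      (by simp) (by simp) ?_
  rintro _ ⟨t, ht, rfl⟩
  have hn := norm_mix_lt nP nP' ht
  have hc : 0 < planeCross (a' - a) ((1 - t) • P + t • P') := by
    rw [planeCross_mix_right]; exact mix_pos hP hP' ht
  refine thin_mem hA hδ hρ0 hρ hc ?_ ?_ hn (by rwa [norm_neg])
  · rw [neg]; linarith
  · rw [neg, self]; simp

theorem eventually_inside {Γ : Fin 3 → Plane} {f : ℝ → Plane} (hf : Continuous f)
    (h : ∀ i, 0 < signedArea (f 0) (Γ i) (Γ (i + 1))) :
    ∀ᶠ δ in nhdsWithin (0 : ℝ) (Set.Ioi 0), ∀ i, 0 < signedArea (f δ) (Γ i) (Γ (i + 1)) := by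
  refine Filter.Eventually.filter_mono nhdsWithin_le_nhds ?_
  rw [Filter.eventually_all]
  intro i
  have hc : Continuous fun δ => signedArea (f δ) (Γ i) (Γ (i + 1)) := by
    simp only [signedArea]; fun_prop
  exact hc.continuousAt.eventually_const_lt (h i)

theorem eventually_extension_inside {A : Finset Plane} (hA : ∀ x, x ∈ A ↔ x = a ∨ x = a')
    {Γ : Fin 3 → Plane} (hΓ : Γ ∈ separatingTriangles A B) :
    ∀ᶠ δ in nhdsWithin (0 : ℝ) (Set.Ioi 0),
      (∀ i, 0 < signedArea (a - δ • (a' - a)) (Γ i) (Γ (i + 1))) ∧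
      ∀ i, 0 < signedArea (a' + δ • (a' - a)) (Γ i) (Γ (i + 1)) :=
  (eventually_inside (f := fun δ => a - δ • (a' - a)) (by fun_prop)
    (by simpa using hΓ.2.1 a ((hA a).2 (Or.inl rfl)))).and
  (eventually_inside (f := fun δ => a' + δ • (a' - a)) (by fun_prop)
    (by simpa using hΓ.2.1 a' ((hA a').2 (Or.inr rfl))))

theorem exists_thickness {Γ : Fin 3 → Plane} {A : Finset Plane} (hΓ : Γ ∈ separatingTriangles A B)
    {z w : Plane} (hz : ∀ i, 0 < signedArea z (Γ i) (Γ (i + 1)))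
    (hw : ∀ i, 0 < signedArea w (Γ i) (Γ (i + 1))) :
    ∃ ρ > 0, ∀ x ∈ segment ℝ z w, ∀ b ∈ B, ρ ≤ dist b x := by
  refine exists_pos_le_dist ?_ B fun b hb hs => hΓ.2.2 b hb
    ((convex_convexHull ℝ _).segment_subset (mem_hull_of_inside hz) (mem_hull_of_inside hw) hs)
  rw [segment_eq_image_lineMap]
  exact isCompact_Icc.image (AffineMap.lineMap_continuous)

/-- Shrinking a triangle to a thin one around the segment. -/
theorem joinedIn_shrink_thin {A : Finset Plane} (hA : ∀ x, x ∈ A ↔ x = a ∨ x = a')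
    {Γ : Fin 3 → Plane} (hΓ : Γ ∈ separatingTriangles A B) (h0 : 0 < signedArea a a' (Γ 0))
    (h1 : signedArea a a' (Γ 1) < 0) {δ : ℝ} (hδ : 0 < δ)
    (hz : ∀ i, 0 < signedArea (a - δ • (a' - a)) (Γ i) (Γ (i + 1)))
    (hw : ∀ i, 0 < signedArea (a' + δ • (a' - a)) (Γ i) (Γ (i + 1))) {s : ℝ} (hs : 0 < s)
    (hs1 : s ≤ 1) :
    JoinedIn (separatingTriangles A B) Γ
      ![a - δ • (a' - a) + s • (Γ 0 - (a - δ • (a' - a))),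
        a - δ • (a' - a) + s • (Γ 1 - (a - δ • (a' - a))), a' + δ • (a' - a)] := by
  have ha := hΓ.2.1 a ((hA a).2 (Or.inl rfl))
  have ha' := hΓ.2.1 a' ((hA a').2 (Or.inr rfl))
  have hne : A.Nonempty := ⟨a, (hA a).2 (Or.inl rfl)⟩
  have eqw : ∀ q : Plane, signedArea a q (a' + δ • (a' - a)) = (1 + δ) * -signedArea a a' q :=
    fun q => by simp [signedArea]; ring
  have eqw' : ∀ q : Plane, signedArea a' q (a' + δ • (a' - a)) = δ * -signedArea a a' q :=
    fun q => by simp [signedArea]; ring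
  have ewp : ∀ p : Plane, signedArea a (a' + δ • (a' - a)) p = (1 + δ) * signedArea a a' p :=
    fun q => by simp [signedArea]; ring
  have ewp' : ∀ p : Plane, signedArea a' (a' + δ • (a' - a)) p = δ * signedArea a a' p :=
    fun q => by simp [signedArea]; ring
  have mixR : ∀ (x p y z : Plane) (t : ℝ), signedArea x p ((1 - t) • y + t • z) =
      (1 - t) * signedArea x p y + t * signedArea x p z := fun x p y z t => by
    simp [signedArea]; ring
  have mixL : ∀ (x p y z : Plane) (t : ℝ), signedArea x ((1 - t) • y + t • z) p =
      (1 - t) * signedArea x y p + t * signedArea x z p := fun x p y z t => by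
    simp [signedArea]; ring
  have hull : ∀ i, Γ i ∈ convexHull ℝ (Set.range Γ) := fun i => subset_convexHull ℝ _ ⟨i, rfl⟩
  have hzh := mem_hull_of_inside hz
  have hwh := mem_hull_of_inside hw
  have s1 : JoinedIn (separatingTriangles A B) Γ ![Γ 0, Γ 1, a' + δ • (a' - a)] := by
    refine JoinedIn.ofLine (f := fun t : ℝ =>
      ![Γ 0, Γ 1, (1 - t) • Γ 2 + t • (a' + δ • (a' - a))])
      (continuous_triple (by fun_prop) (by fun_prop) (by fun_prop)).continuousOn
      (by funext i; fin_cases i <;> simp) (by simp) ?_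
    rintro _ ⟨t, ht, rfl⟩
    refine mem_separatingTriangles_of_subset hne hΓ (fun i => ?_) ?_
    · fin_cases i
      · exact hull 0
      · exact hull 1
      · exact (convex_convexHull ℝ _) (hull 2) hwh (sub_nonneg.2 ht.2) ht.1 (by ring)
    · intro x hx
      rcases (hA x).1 hx with rfl | rfl
      · refine inside_of_signs (ha 0) ?_ ?_
        · rw [mixR, eqw]
          exact mix_pos (ha 1) (mul_pos (by linarith) (by linarith)) ht
        · rw [mixL, ewp]
          exact mix_pos (ha 2) (mul_pos (by linarith) (by linarith)) ht
      · refine inside_of_signs (ha' 0) ?_ ?_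
        · rw [mixR, eqw']
          exact mix_pos (ha' 1) (mul_pos (by linarith) (by linarith)) ht
        · rw [mixL, ewp']
          exact mix_pos (ha' 2) (mul_pos (by linarith) (by linarith)) ht
  refine s1.trans ?_
  refine JoinedIn.ofLine (f := fun t : ℝ =>
      ![a - δ • (a' - a) + (1 - t + t * s) • (Γ 0 - (a - δ • (a' - a))),
        a - δ • (a' - a) + (1 - t + t * s) • (Γ 1 - (a - δ • (a' - a))), a' + δ • (a' - a)])
      (continuous_triple (by fun_prop) (by fun_prop) (by fun_prop)).continuousOn
      (by simp) (by simp) ?_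
  rintro _ ⟨t, ht, rfl⟩
  have h0' : 0 < 1 - t + t * s := by
    have := mix_pos one_pos hs ht
    linarith
  have h1' : 1 - t + t * s ≤ 1 := by nlinarith [ht.1]
  have hzp := hz 0
  rw [zero_add] at hzp
  beta_reduce
  generalize 1 - t + t * s = l at h0' h1' ⊢
  have hm : ∀ i, a - δ • (a' - a) + l • (Γ i - (a - δ • (a' - a))) ∈
      convexHull ℝ (Set.range Γ) := fun i => by
    have := (convex_convexHull ℝ (Set.range Γ)) hzh (hull i) (sub_nonneg.2 h1') h0'.le (by ring)
    convert this using 1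
    module
  have epq : ∀ (m : ℝ), signedArea (a + m • (a' - a))
      (a - δ • (a' - a) + l • (Γ 0 - (a - δ • (a' - a))))
      (a - δ • (a' - a) + l • (Γ 1 - (a - δ • (a' - a)))) =
      l ^ 2 * signedArea (a - δ • (a' - a)) (Γ 0) (Γ 1) +
      l * (m + δ) * (signedArea a a' (Γ 0) - signedArea a a' (Γ 1)) := fun m => by
    simp [signedArea]; ring
  have esc : ∀ q : Plane, signedArea a a' (a - δ • (a' - a) + l • (q - (a - δ • (a' - a)))) =
      l * signedArea a a' q := fun q => by simp [signedArea]; ring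
  have hd : 0 < signedArea a a' (Γ 0) - signedArea a a' (Γ 1) := by linarith
  have n0 := mul_pos h0' h0
  have n1 := mul_pos h0' (neg_pos.2 h1)
  refine mem_separatingTriangles_of_subset hne hΓ (fun i => ?_) ?_
  · fin_cases i
    · exact hm 0
    · exact hm 1
    · exact hwh
  · intro x hx
    rcases (hA x).1 hx with rfl | rfl
    · refine inside_of_signs ?_ ?_ ?_
      · have := epq 0
        rw [zero_smul, add_zero] at this
        rw [this]; positivity
      · rw [eqw, esc]; exact mul_pos (by linarith) (by linarith)
      · rw [ewp, esc]; exact mul_pos (by linarith) n0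
    · refine inside_of_signs ?_ ?_ ?_
      · have := epq 1
        rw [one_smul, add_sub_cancel] at this
        rw [this]; positivity
      · rw [eqw', esc]; exact mul_pos (by linarith) (by linarith)
      · rw [ewp', esc]; exact mul_pos (by linarith) n0

/-- Triangles whose `i`-th side crosses the line through `a` and `a'` downwards. -/
def crossingTriangles (A B : Finset Plane) (a a' : Plane) (i : Fin 3) : Set (Fin 3 → Plane) :=
  {Γ | Γ ∈ separatingTriangles A B ∧ 0 < signedArea a a' (Γ i) ∧ signedArea a a' (Γ (i + 1)) < 0}

theorem joinedIn_of_crossing_zero {A : Finset Plane} (hA : ∀ x, x ∈ A ↔ x = a ∨ x = a')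
    {Γ Γ' : Fin 3 → Plane} (hΓ : Γ ∈ crossingTriangles A B a a' 0)
    (hΓ' : Γ' ∈ crossingTriangles A B a a' 0) : JoinedIn (separatingTriangles A B) Γ Γ' := by
  obtain ⟨m, h0, h1⟩ := hΓ
  obtain ⟨m', h0', h1'⟩ := hΓ'
  rw [zero_add] at h1 h1'
  obtain ⟨δ, ⟨⟨hz, hw⟩, hz', hw'⟩, hδ⟩ := (((eventually_extension_inside hA m).and
    (eventually_extension_inside hA m')).and self_mem_nhdsWithin).exists
  obtain ⟨ρ, hρ0, hρ⟩ := exists_thickness m hz hw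
  obtain ⟨s, hs, hs1, hsR⟩ := exists_scale_lt (R := ‖Γ 0 - (a - δ • (a' - a))‖ +
    ‖Γ 1 - (a - δ • (a' - a))‖ + ‖Γ' 0 - (a - δ • (a' - a))‖ + ‖Γ' 1 - (a - δ • (a' - a))‖) hρ0
  have esc : ∀ q : Plane, planeCross (a' - a) (s • (q - (a - δ • (a' - a)))) =
      s * signedArea a a' q := fun q => by simp [signedArea, planeCross]; ring
  have epq : ∀ p q : Plane, planeCross (s • (p - (a - δ • (a' - a))))
      (s • (q - (a - δ • (a' - a)))) = s ^ 2 * signedArea (a - δ • (a' - a)) p q := fun p q => by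
    simp [signedArea, planeCross]; ring
  have hn : ∀ x : Plane, ‖x‖ ≤ ‖Γ 0 - (a - δ • (a' - a))‖ +
      ‖Γ 1 - (a - δ • (a' - a))‖ + ‖Γ' 0 - (a - δ • (a' - a))‖ + ‖Γ' 1 - (a - δ • (a' - a))‖ →
      ‖s • x‖ < ρ := fun x hx => by
    rw [norm_smul, Real.norm_of_nonneg hs.le]
    exact (mul_le_mul_of_nonneg_left hx hs.le).trans_lt hsR
  have n1 := norm_nonneg (Γ 0 - (a - δ • (a' - a)))
  have n2 := norm_nonneg (Γ 1 - (a - δ • (a' - a)))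
  have n3 := norm_nonneg (Γ' 0 - (a - δ • (a' - a)))
  have n4 := norm_nonneg (Γ' 1 - (a - δ • (a' - a)))
  have z0 := hz 0
  have z0' := hz' 0
  rw [zero_add] at z0 z0'
  refine ((joinedIn_shrink_thin hA m h0 h1 hδ hz hw hs hs1).trans ?_).trans
    (joinedIn_shrink_thin hA m' h0' h1' hδ hz' hw' hs hs1).symm
  refine joinedIn_thin hA hδ hρ0 hρ ?_ ?_ ?_ (hn _ (by linarith)) (hn _ (by linarith)) ?_ ?_ ?_
    (hn _ (by linarith)) (hn _ (by linarith))
  · rw [esc]; exact mul_pos hs h0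
  · rw [esc]; exact mul_neg_of_pos_of_neg hs h1
  · rw [epq]; positivity
  · rw [esc]; exact mul_pos hs h0'
  · rw [esc]; exact mul_neg_of_pos_of_neg hs h1'
  · rw [epq]; positivity

theorem rotate_mem_separatingTriangles {A B : Finset Plane} {Γ : Fin 3 → Plane} (j : Fin 3)
    (h : Γ ∈ separatingTriangles A B) : (fun k => Γ (k + j)) ∈ separatingTriangles A B := by
  have e : ∀ k : Fin 3, k + 1 + j = k + j + 1 := fun k => add_right_comm k 1 j
  refine ⟨?_, fun a ha k => ?_, fun b hb => ?_⟩
  · have := signedArea_rotate_index Γ j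
    have h1 := h.1
    rw [← this] at h1
    simp only [triangleArea, zero_add]
    rwa [add_comm 1 j, add_comm 2 j]
  · simp only [e]; exact h.2.1 a ha _
  · have : Set.range (fun k => Γ (k + j)) = Set.range Γ :=
      (Equiv.addRight j).surjective.range_comp Γ
    rw [this]; exact h.2.2 b hb

theorem joinedIn_of_crossing {A : Finset Plane} (hA : ∀ x, x ∈ A ↔ x = a ∨ x = a') {i : Fin 3}
    {Γ Γ' : Fin 3 → Plane} (hΓ : Γ ∈ crossingTriangles A B a a' i)
    (hΓ' : Γ' ∈ crossingTriangles A B a a' i) : JoinedIn (separatingTriangles A B) Γ Γ' := by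
  have r : ∀ Γ ∈ crossingTriangles A B a a' i,
      (fun k => Γ (k + i)) ∈ crossingTriangles A B a a' 0 := fun Γ h =>
    ⟨rotate_mem_separatingTriangles i h.1, by simpa using h.2.1,
      by simpa [add_comm] using h.2.2⟩
  have h2 := (joinedIn_of_crossing_zero hA (r Γ hΓ) (r Γ' hΓ')).map
    (f := fun Γ : Fin 3 → Plane => fun k => Γ (k + -i)) (by fun_prop)
  have e : ∀ Γ : Fin 3 → Plane, (fun k => Γ (k + -i + i)) = Γ := fun Γ => by
    funext k; rw [neg_add_cancel_right]
  simp only [e] at h2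
  refine h2.mono ?_
  rintro _ ⟨Γ, hΓ, rfl⟩
  exact rotate_mem_separatingTriangles (-i) hΓ

theorem exists_thin_crossing_both {A : Finset Plane} (hA : ∀ x, x ∈ A ↔ x = a ∨ x = a')
    (hne : a ≠ a') {Γ : Fin 3 → Plane} (hΓ : Γ ∈ separatingTriangles A B) (i : Fin 3) :
    ∃ Γ', Γ' ∈ crossingTriangles A B a a' i ∧ Γ' ∈ crossingTriangles A B a' a (i + 1) := by
  have lt1 : ∀ᶠ δ : ℝ in nhdsWithin 0 (Set.Ioi 0), δ < 1 :=
    Filter.Eventually.filter_mono nhdsWithin_le_nhds (eventually_lt_nhds one_pos)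
  obtain ⟨δ, ⟨⟨hz, hw⟩, hδ1⟩, hδ⟩ := (((eventually_extension_inside hA hΓ).and lt1).and
    self_mem_nhdsWithin).exists
  have hδ : 0 < δ := hδ
  obtain ⟨ρ, hρ0, hρ⟩ := exists_thickness hΓ hz hw
  set J : Plane := !₂[-(a' 1 - a 1), a' 0 - a 0] with hJ
  have J0 : J 0 = -(a' 1 - a 1) := rfl
  have J1 : J 1 = a' 0 - a 0 := rfl
  obtain ⟨η, hη, -, hηR⟩ := exists_scale_lt (R := ‖J‖) hρ0
  have hN : 0 < (a' 0 - a 0) ^ 2 + (a' 1 - a 1) ^ 2 := by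
    by_contra! h
    have h0 : a' 0 - a 0 = 0 := by nlinarith [sq_nonneg (a' 0 - a 0), sq_nonneg (a' 1 - a 1)]
    have h1 : a' 1 - a 1 = 0 := by nlinarith [sq_nonneg (a' 0 - a 0), sq_nonneg (a' 1 - a 1)]
    exact hne (plane_ext (by linarith) (by linarith))
  have hn : ∀ c : ℝ, |c| ≤ 1 → ‖(c * η) • J‖ < ρ := fun c hc => by
    rw [norm_smul, Real.norm_eq_abs, abs_mul, abs_of_pos hη, mul_assoc]
    refine lt_of_le_of_lt (mul_le_of_le_one_left (by positivity) hc) hηR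
  let Θ : Fin 3 → Plane := ![a - δ • (a' - a) + (δ / 2 * η) • J, a' + δ • (a' - a) + (-1 * η) • J,
    a' + δ • (a' - a) + (1 * η) • J]
  have hΘ : Θ ∈ separatingTriangles A B := by
    have area : ∀ (k m n m' n' : ℝ), signedArea (a + k • (a' - a)) (a + m • (a' - a) + n • J)
        (a + m' • (a' - a) + n' • J) = ((m - k) * n' - n * (m' - k)) *
        ((a' 0 - a 0) ^ 2 + (a' 1 - a 1) ^ 2) := fun k m n m' n' => by
      simp [signedArea, J0, J1]; ring
    have ez : a - δ • (a' - a) = a + (-δ) • (a' - a) := by module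
    have ew : a' + δ • (a' - a) = a + (1 + δ) • (a' - a) := by module
    have e0 : a = a + (0 : ℝ) • (a' - a) := by module
    have e1 : a' = a + (1 : ℝ) • (a' - a) := by module
    have key : ∀ k : ℝ, 0 ≤ k → k ≤ 1 → ∀ i, 0 < signedArea (a + k • (a' - a)) (Θ i) (Θ (i + 1)) := by
      intro k hk hk1
      simp only [Θ, ez, ew]
      have q1 : 0 < δ * η := mul_pos hδ hη
      have q2 : 0 ≤ k * η := mul_nonneg hk hη.le
      have q3 : 0 ≤ (1 - k) * η := mul_nonneg (by linarith) hη.le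
      have q4 : 0 < δ * η * (1 - δ) := mul_pos q1 (by linarith)
      have q5 : 0 ≤ k * η * δ := mul_nonneg q2 hδ.le
      have q6 : 0 ≤ (1 - k) * η * δ := mul_nonneg q3 hδ.le
      have q7 : 0 < δ * η * δ := mul_pos q1 hδ
      refine inside_of_signs ?_ ?_ ?_ <;> rw [area] <;> refine mul_pos ?_ hN <;> nlinarith
    have k0 := key 0 le_rfl zero_le_one
    have k1 := key 1 zero_le_one le_rfl
    rw [← e0] at k0
    rw [← e1] at k1
    refine mem_of_inside_pair hA k0 k1 fun b hb => ?_
    refine not_mem_hull_of_thickening (convex_segment _ _) (fun i => ?_) (fun x hx => hρ x hx b hb)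
    fin_cases i
    · refine add_mem_thickening (left_mem_segment _ _ _) (hn _ ?_)
      rw [abs_of_pos (by positivity)]; linarith
    · exact add_mem_thickening (right_mem_segment _ _ _) (hn _ (by simp))
    · exact add_mem_thickening (right_mem_segment _ _ _) (hn _ (by simp))
  have σ0 : 0 < signedArea a a' (Θ 0) := by
    have : signedArea a a' (Θ 0) = (δ / 2 * η) * ((a' 0 - a 0) ^ 2 + (a' 1 - a 1) ^ 2) := by
      simp [Θ, signedArea, J0, J1]; ring
    rw [this]; positivity
  have σ1 : signedArea a a' (Θ 1) < 0 := by
    have : signedArea a a' (Θ 1) = -(η * ((a' 0 - a 0) ^ 2 + (a' 1 - a 1) ^ 2)) := by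
      simp [Θ, signedArea, J0, J1]; ring
    rw [this]; exact neg_neg_of_pos (by positivity)
  have σ2 : 0 < signedArea a a' (Θ 2) := by
    have : signedArea a a' (Θ 2) = η * ((a' 0 - a 0) ^ 2 + (a' 1 - a 1) ^ 2) := by
      simp [Θ, signedArea, J0, J1]; ring
    rw [this]; positivity
  have flip : ∀ x, signedArea a' a x = -signedArea a a' x := fun x => by
    simp only [signedArea]; ring
  have i0 : i + -i = 0 := add_neg_cancel i
  have i1 : i + 1 + -i = 1 := by rw [add_comm i 1, add_neg_cancel_right]
  have i2 : i + 1 + 1 + -i = 2 := (by decide : ∀ i : Fin 3, i + 1 + 1 + -i = 2) i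
  refine ⟨fun k => Θ (k + -i), ⟨rotate_mem_separatingTriangles _ hΘ, ?_, ?_⟩,
    ⟨rotate_mem_separatingTriangles _ hΘ, ?_, ?_⟩⟩
  · simpa only [i0] using σ0
  · simpa only [i1] using σ1
  · simp only [i1, flip]; linarith
  · simp only [i2, flip]; linarith

theorem exists_crossing {A : Finset Plane} (hA : ∀ x, x ∈ A ↔ x = a ∨ x = a') (hne : a ≠ a')
    {Γ : Fin 3 → Plane} (hΓ : Γ ∈ separatingTriangles A B) :
    ∃ i, Γ ∈ crossingTriangles A B a a' i ∨ Γ ∈ crossingTriangles A B a' a i := by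
  have ha := hΓ.2.1 a ((hA a).2 (Or.inl rfl))
  have flip : ∀ x, signedArea a' a x = -signedArea a a' x := fun x => by
    simp only [signedArea]; ring
  have d0 : 0 < signedArea a (Γ 0) (Γ 1) := ha 0
  have d1 : 0 < signedArea a (Γ 1) (Γ 2) := ha 1
  have d2 : 0 < signedArea a (Γ 2) (Γ 0) := ha 2
  have bal : signedArea a (Γ 1) (Γ 2) * signedArea a a' (Γ 0) +
      signedArea a (Γ 2) (Γ 0) * signedArea a a' (Γ 1) +
      signedArea a (Γ 0) (Γ 1) * signedArea a a' (Γ 2) = 0 := by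
    simp only [signedArea]; ring
  have nz : ¬ (signedArea a a' (Γ 0) = 0 ∧ signedArea a a' (Γ 1) = 0) := by
    rintro ⟨e0, e1⟩
    have f0 : signedArea a (Γ 0) (Γ 1) * (a' 0 - a 0) = 0 := by
      simp only [signedArea] at *
      linear_combination (Γ 0 0 - a 0) * e1 - (Γ 1 0 - a 0) * e0
    have f1 : signedArea a (Γ 0) (Γ 1) * (a' 1 - a 1) = 0 := by
      simp only [signedArea] at *
      linear_combination (Γ 0 1 - a 1) * e1 - (Γ 1 1 - a 1) * e0
    have g0 := (mul_eq_zero.1 f0).resolve_left d0.ne'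
    have g1 := (mul_eq_zero.1 f1).resolve_left d0.ne'
    exact hne (plane_ext (by linarith) (by linarith))
  have hpos : ∃ i, 0 < signedArea a a' (Γ i) := by
    by_contra! hc
    have c0 := mul_nonneg d1.le (neg_nonneg.2 (hc 0))
    have c1 := mul_nonneg d2.le (neg_nonneg.2 (hc 1))
    have c2 := mul_nonneg d0.le (neg_nonneg.2 (hc 2))
    refine nz ⟨?_, ?_⟩
    · exact (mul_eq_zero.1 (by linarith :
        signedArea a (Γ 1) (Γ 2) * signedArea a a' (Γ 0) = 0)).resolve_left d1.ne'
    · exact (mul_eq_zero.1 (by linarith :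
        signedArea a (Γ 2) (Γ 0) * signedArea a a' (Γ 1) = 0)).resolve_left d2.ne'
  have hneg : ∃ i, signedArea a a' (Γ i) < 0 := by
    by_contra! hc
    have c0 := mul_nonneg d1.le (hc 0)
    have c1 := mul_nonneg d2.le (hc 1)
    have c2 := mul_nonneg d0.le (hc 2)
    refine nz ⟨?_, ?_⟩
    · exact (mul_eq_zero.1 (by linarith :
        signedArea a (Γ 1) (Γ 2) * signedArea a a' (Γ 0) = 0)).resolve_left d1.ne'
    · exact (mul_eq_zero.1 (by linarith :
        signedArea a (Γ 2) (Γ 0) * signedArea a a' (Γ 1) = 0)).resolve_left d2.ne'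
  obtain ⟨i, hi⟩ := hpos
  obtain ⟨j, hj⟩ := hneg
  have e : j = i ∨ j = i + 1 ∨ i = j + 1 :=
    (by decide : ∀ i j : Fin 3, j = i ∨ j = i + 1 ∨ i = j + 1) i j
  rcases e with rfl | rfl | rfl
  · linarith
  · exact ⟨i, Or.inl ⟨hΓ, hi, hj⟩⟩
  · exact ⟨j, Or.inr ⟨hΓ, by rw [flip]; linarith, by rw [flip]; linarith⟩⟩

/-- Triangles around two points form a connected space, whatever lies outside. -/
theorem joinedIn_of_two_inside {A : Finset Plane} (hA : ∀ x, x ∈ A ↔ x = a ∨ x = a') (hne : a ≠ a')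
    {Γ Γ' : Fin 3 → Plane} (hΓ : Γ ∈ separatingTriangles A B)
    (hΓ' : Γ' ∈ separatingTriangles A B) : JoinedIn (separatingTriangles A B) Γ Γ' := by
  have hA' : ∀ x, x ∈ A ↔ x = a' ∨ x = a := fun x => (hA x).trans or_comm
  choose e he he' using exists_thin_crossing_both hA hne hΓ
  choose f hf hf' using exists_thin_crossing_both hA' hne.symm hΓ
  have two : ∀ (i : Fin 3) (Γ Γ' : Fin 3 → Plane), Γ ∈ crossingTriangles A B a a' i →
      Γ' ∈ crossingTriangles A B a a' (i + 1 + 1) →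
      JoinedIn (separatingTriangles A B) Γ Γ' := fun i Γ Γ' h h' =>
    ((joinedIn_of_crossing hA h (he i)).trans (joinedIn_of_crossing hA' (he' i) (hf (i + 1)))).trans
      (joinedIn_of_crossing hA (hf' (i + 1)) h')
  have all : ∀ (i j : Fin 3) (Γ Γ' : Fin 3 → Plane), Γ ∈ crossingTriangles A B a a' i →
      Γ' ∈ crossingTriangles A B a a' j → JoinedIn (separatingTriangles A B) Γ Γ' := by
    intro i j Γ Γ' h h'
    have e : j = i ∨ i = j + 1 + 1 ∨ j = i + 1 + 1 :=
      (by decide : ∀ i j : Fin 3, j = i ∨ i = j + 1 + 1 ∨ j = i + 1 + 1) i j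
    rcases e with rfl | rfl | rfl
    · exact joinedIn_of_crossing hA h h'
    · exact (two _ _ _ h' h).symm
    · exact two _ _ _ h h'
  have base : ∀ Γ ∈ separatingTriangles A B, JoinedIn (separatingTriangles A B) Γ (e 0) := by
    intro Γ hΓ
    obtain ⟨i, h | h⟩ := exists_crossing hA hne hΓ
    · exact all _ _ _ _ h (he 0)
    · have h2 := he' (i + 2)
      rw [(by decide : ∀ i : Fin 3, i + 2 + 1 = i) i] at h2
      exact (joinedIn_of_crossing hA' h h2).trans (all _ _ _ _ (he _) (he 0))
  exact (base Γ hΓ).trans (base Γ' hΓ').symm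

end TwoInside

theorem joinedIn_separatingTriangles {A B : Finset Plane} (h : A.card + B.card ≤ 4)
    {Γ Γ' : Fin 3 → Plane} (hΓ : Γ ∈ separatingTriangles A B)
    (hΓ' : Γ' ∈ separatingTriangles A B) : JoinedIn (separatingTriangles A B) Γ Γ' := by
  rcases lt_or_ge A.card 3 with h3 | h3
  · have : A.card = 0 ∨ A.card = 1 ∨ A.card = 2 := by omega
    rcases this with h0 | h1 | h2
    · obtain rfl := Finset.card_eq_zero.1 h0
      exact joinedIn_of_none_inside hΓ hΓ'
    · obtain ⟨c, rfl⟩ := Finset.card_eq_one.1 h1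
      exact joinedIn_of_one_inside hΓ hΓ'
    · obtain ⟨a, a', hne, rfl⟩ := Finset.card_eq_two.1 h2
      exact joinedIn_of_two_inside (fun x => by simp) hne hΓ hΓ'
  · have hA : A.Nonempty := Finset.card_pos.1 (by omega)
    have : B.card = 0 ∨ B.card = 1 := by omega
    rcases this with h0 | h1
    · obtain rfl := Finset.card_eq_zero.1 h0
      exact joinedIn_of_no_outside hA hΓ hΓ'
    · obtain ⟨b, rfl⟩ := Finset.card_eq_one.1 h1
      exact joinedIn_of_one_outside hA b hΓ hΓ'

/-- `x` lies in the interior of the triangle, of either orientation. -/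
def InsideTriangle (Γ : Fin 3 → Plane) (x : Plane) : Prop :=
  (∀ i, 0 < signedArea x (Γ i) (Γ (i + 1))) ∨ ∀ i, signedArea x (Γ i) (Γ (i + 1)) < 0

theorem Compatible.symm {V : Type*} {G : SimpleGraph V} {Γ₁ Γ₂ : V → Plane} {P : Finset Plane}
    (h : Compatible G Γ₁ Γ₂ P) : Compatible G Γ₂ Γ₁ P := by
  obtain ⟨D, hV, hE, hD0, hD1, hD⟩ := h
  refine ⟨fun t => D (unitInterval.symm t), fun v => (hV v).comp unitInterval.continuous_symm,
    fun d => ?_, by simpa using hD1, by simpa using hD0, fun t => hD _⟩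
  exact (hE d).comp (f := fun p : unitInterval × unitInterval => (unitInterval.symm p.1, p.2))
    (by fun_prop)

theorem Compatible.mem_freeTriangles {Γ₁ Γ₂ : Fin 3 → Plane} {P : Finset Plane}
    (h : Compatible (SimpleGraph.cycleGraph 3) Γ₁ Γ₂ P) : Γ₁ ∈ freeTriangles P := by
  obtain ⟨D, -, -, hD0, -, hD⟩ := h
  have := hD 0
  rw [hD0] at this
  exact ⟨IsDrawing.triangleArea_ne_zero this.1, avoids_iff.1 this.2⟩

theorem insideTriangle_iff_of_pos {Γ : Fin 3 → Plane} (h : 0 < triangleArea Γ) (x : Plane) :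
    InsideTriangle Γ x ↔ ∀ i, 0 < signedArea x (Γ i) (Γ (i + 1)) := by
  refine ⟨fun hx => hx.resolve_right fun hn => ?_, Or.inl⟩
  have h0 : signedArea x (Γ 0) (Γ 1) < 0 := hn 0
  have h1 : signedArea x (Γ 1) (Γ 2) < 0 := hn 1
  have h2 : signedArea x (Γ 2) (Γ 0) < 0 := hn 2
  linarith [sum_signedArea Γ x]

theorem joinedIn_of_pos {Γ₁ Γ₂ : Fin 3 → Plane} {P : Finset Plane} (hP : P.card ≤ 4)
    (h₁ : Γ₁ ∈ freeTriangles P) (h₂ : Γ₂ ∈ freeTriangles P) (p₁ : 0 < triangleArea Γ₁)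
    (p₂ : 0 < triangleArea Γ₂) (h : ∀ x ∈ P, InsideTriangle Γ₁ x ↔ InsideTriangle Γ₂ x) :
    JoinedIn (freeTriangles P) Γ₁ Γ₂ := by
  classical
  have hc := Finset.card_filter_add_card_filter_not (s := P) (InsideTriangle Γ₁)
  have m₁ : Γ₁ ∈ separatingTriangles (P.filter (InsideTriangle Γ₁))
      (P.filter fun x => ¬ InsideTriangle Γ₁ x) :=
    mem_separatingTriangles_of_free h₁ p₁
      (fun a ha => (insideTriangle_iff_of_pos p₁ a).1 (Finset.mem_filter.1 ha).2)
      (fun b hb => ⟨(Finset.mem_filter.1 hb).1,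
        fun hi => (Finset.mem_filter.1 hb).2 ((insideTriangle_iff_of_pos p₁ b).2 hi)⟩)
  have m₂ : Γ₂ ∈ separatingTriangles (P.filter (InsideTriangle Γ₁))
      (P.filter fun x => ¬ InsideTriangle Γ₁ x) := by
    refine mem_separatingTriangles_of_free h₂ p₂ (fun a ha => ?_) (fun b hb => ?_)
    · obtain ⟨ha, hi⟩ := Finset.mem_filter.1 ha
      exact (insideTriangle_iff_of_pos p₂ a).1 ((h a ha).1 hi)
    · obtain ⟨hb, hi⟩ := Finset.mem_filter.1 hb
      exact ⟨hb, fun h' => hi ((h b hb).2 ((insideTriangle_iff_of_pos p₂ b).2 h'))⟩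
  refine (joinedIn_separatingTriangles (by omega) m₁ m₂).mono ?_
  have := separatingTriangles_subset (P.filter (InsideTriangle Γ₁))
    (P.filter fun x => ¬ InsideTriangle Γ₁ x)
  rwa [Finset.filter_union_filter_not_eq] at this

theorem insideTriangle_comp_swap (Γ : Fin 3 → Plane) (x : Plane) :
    InsideTriangle (Γ ∘ Equiv.swap 0 1) x ↔ InsideTriangle Γ x := by
  have e2 : (Equiv.swap (0 : Fin 3) 1) 2 = 2 := rfl
  have s : ∀ p q : Plane, signedArea x p q = - signedArea x q p := fun p q => by
    simp only [signedArea]; ring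
  have e3 : (2 : Fin 3) + 1 = 0 := rfl
  have e4 : (1 : Fin 3) + 1 = 2 := rfl
  simp only [InsideTriangle, Fin.forall_fin_succ, Function.comp, Fin.succ_zero_eq_one,
    Fin.succ_one_eq_two, zero_add, e3, e4, e2, Equiv.swap_apply_left, Equiv.swap_apply_right,
    IsEmpty.forall_iff, and_true]
  rw [s (Γ 1) (Γ 0), s (Γ 0) (Γ 2), s (Γ 2) (Γ 1)]
  simp only [Left.neg_pos_iff, Left.neg_neg_iff]
  tauto

theorem proposition3 (Γ₁ Γ₂ : Fin 3 → Plane)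
    (h₁ : IsDrawing (SimpleGraph.cycleGraph 3) Γ₁)
    (h₂ : IsDrawing (SimpleGraph.cycleGraph 3) Γ₂) :
    ¬ ∃ P : Finset Plane, P.card ≤ 4 ∧
      Compatible (SimpleGraph.cycleGraph 3) Γ₁ Γ₂ P ∧
      Blocked (SimpleGraph.cycleGraph 3) Γ₁ Γ₂ P := by
  rintro ⟨P, hP, hc, hb⟩
  have f₁ := hc.mem_freeTriangles
  have f₂ := hc.symm.mem_freeTriangles
  have hin : ∀ x ∈ P, InsideTriangle Γ₁ x ↔ InsideTriangle Γ₂ x := fun x hx =>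
    ⟨Or.imp (hc.inside hx).1 (hc.inside hx).2,
      Or.imp (hc.symm.inside hx).1 (hc.symm.inside hx).2⟩
  refine not_blocked_of_joinedIn ?_ hb
  rcases lt_or_gt_of_ne h₁.triangleArea_ne_zero with n | p
  · refine joinedIn_freeTriangles_of_comp (joinedIn_of_pos hP (comp_swap_mem_freeTriangles f₁)
      (comp_swap_mem_freeTriangles f₂) ?_ ?_ ?_)
    · rw [triangleArea_comp_swap]; linarith
    · rw [triangleArea_comp_swap]
      exact neg_pos.2 (hc.orientation.2 n)
    · intro x hx
      rw [insideTriangle_comp_swap, insideTriangle_comp_swap]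
      exact hin x hx
  · exact joinedIn_of_pos hP f₁ f₂ p (hc.orientation.1 p) hin
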